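/- Let $m,M\ge 1$ be finite integers, and let $S^m$ denote the unit sphere of $\mathbb{R}^{m+1}$. Let $K$ be a real continuous isotropic kernel on $S^m\times S^M$, that is, $K((x,z),(y,w))=f(x\cdot y,z\cdot w)$ for all $x,y\in S^m$, $z,w\in S^M$, with a real function $f$ on $[-1,1]^2$ (the isotropic part of $K$). The kernel $K$ is called positive definite if $\sum_{\mu,\nu=1}^n c_\mu c_\nu K(p_\mu,p_\nu)\ge 0$ for all $n\ge 1$, all distinct points $p_1,\dots,p_n\in S^m\times S^M$ and all real $c_1,\dots,c_n$. For $m\ge 2$ let $P_k^m=C_k^{((m-1)/2)}$ be the Gegenbauer polynomial of degree $k$ and parameter $(m-1)/2$, given by $\sum_{k\ge 0}C_k^{(\lambda)}(t)r^k=(1-2tr+r^2)^{-\lambda}$; for $m=1$ let $P_k^1=T_k$ be the Chebyshev polynomial, $T_k(\cos\theta)=\cos k\theta$. Put $w_m(t)=(1-t^2)^{(m-2)/2}$ and $\tau_k^m=\int_{-1}^1 P_k^m(t)^2\,w_m(t)\,dt$, and let $$\hat f_{k,l}=\frac{1}{\tau_k^m\tau_l^M}\int_{[-1,1]^2} f(t,s)\,P_k^m(t)\,P_l^M(s)\,w_m(t)\,w_M(s)\,dt\,ds,\qquad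 k,l\ge 0,$$ be the Fourier coefficients of $f$ with respect to the orthogonal family $P_k^m(t)P_l^M(s)$. Then $K$ is positive definite on $S^m\times S^M$ if and only if $$f(t,s)=\sum_{k,l=0}^{\infty}\hat f_{k,l}\,P_k^m(t)\,P_l^M(s),\qquad t,s\in[-1,1],$$ with $\hat f_{k,l}\ge 0$ for all $k,l\ge 0$ and $\sum_{k,l=0}^{\infty}\hat f_{k,l}\,P_k^m(1)\,P_l^M(1)<\infty$ (the double series being summed absolutely). Likewise, $K$ is positive definite if and only if there are some real numbers $a_{k,l}$ for which the same three conditions hold with $a_{k,l}$ in place of $\hat f_{k,l}$. -/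

import Mathlib

/-- The unit sphere `S^m` of `ℝ^(m+1)`. -/
abbrev USphere (m : ℕ) : Type :=
  Metric.sphere (0 : EuclideanSpace ℝ (Fin (m + 1))) 1

/-- A real kernel `K` on `X` is positive definite if `∑ c_μ c_ν K(x_μ, x_ν) ≥ 0` for all finite
families of distinct points of `X` and all real scalars. -/
def IsPosDefKernel {X : Type*} (K : X → X → ℝ) : Prop :=
  ∀ (n : ℕ) (x : Fin n → X), Function.Injective x → ∀ c : Fin n → ℝ,
    0 ≤ ∑ i, ∑ j, c i * c j * K (x i) (x j)

/-- The kernel `K` on `S^m × S^M` is isotropic with isotropic part `f`: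
`K((x,z),(y,w)) = f(x·y, z·w)`. Only the values of `f` on `[-1,1]²` enter. -/
def IsIsotropicPart {m M : ℕ} (f : ℝ → ℝ → ℝ)
    (K : USphere m × USphere M → USphere m × USphere M → ℝ) : Prop :=
  ∀ (x y : USphere m) (z w : USphere M),
    K (x, z) (y, w) =
      f (inner ℝ (x : EuclideanSpace ℝ (Fin (m + 1))) (y : EuclideanSpace ℝ (Fin (m + 1))))
        (inner ℝ (z : EuclideanSpace ℝ (Fin (M + 1))) (w : EuclideanSpace ℝ (Fin (M + 1))))

/-- The Gegenbauer (ultraspherical) polynomial `C_k^a` of degree `k` and parameter `a`, in the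
classical normalization with generating function `(1 - 2 t r + r²)^(-a)`, through its three-term
recurrence `(k+2) C_{k+2} = 2 (k+1+a) t C_{k+1} - (k+2a) C_k`. -/
noncomputable def gegenbauer (a : ℝ) : ℕ → Polynomial ℝ
  | 0 => 1
  | 1 => Polynomial.C (2 * a) * Polynomial.X
  | k + 2 =>
      Polynomial.C (2 * ((k : ℝ) + 1 + a) / ((k : ℝ) + 2)) * Polynomial.X * gegenbauer a (k + 1)
        - Polynomial.C (((k : ℝ) + 2 * a) / ((k : ℝ) + 2)) * gegenbauer a k

/-- The polynomial `P_k^m` attached to the sphere `S^m`, `m ≥ 1`: the Gegenbauer polynomial of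
parameter `(m-1)/2` for `m ≥ 2`. For `m = 1` (the limiting parameter `0`, at which `C_k^a`
degenerates) it is the Chebyshev polynomial `T_k`, so that `P_k^1(cos θ) = cos (k θ)`. -/
noncomputable def sphereP (m k : ℕ) : Polynomial ℝ :=
  if m = 1 then Polynomial.Chebyshev.T ℝ (k : ℤ) else gegenbauer (((m : ℝ) - 1) / 2) k

/-- The weight `(1-t²)^((m-2)/2)` on `[-1,1]` for which the `P_k^m` are orthogonal. -/
noncomputable def sphereWeight (m : ℕ) (t : ℝ) : ℝ :=
  (1 - t ^ 2) ^ (((m : ℝ) - 2) / 2)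

/-- The normalizing constant `τ_k^m`: the weighted squared norm of `P_k^m` on `[-1,1]`. -/
noncomputable def sphereNormSq (m k : ℕ) : ℝ :=
  ∫ t in Set.Icc (-1 : ℝ) 1, (sphereP m k).eval t ^ 2 * sphereWeight m t

/-- The `(k,l)`-Fourier coefficient of `f` with respect to the tensor family
`P_k^m(t) P_l^M(s)` on `[-1,1]²`. -/
noncomputable def fourierCoeffPS (m M : ℕ) (f : ℝ → ℝ → ℝ) (k l : ℕ) : ℝ :=
  (1 / (sphereNormSq m k * sphereNormSq M l)) *
    ∫ p in Set.Icc (-1 : ℝ) 1 ×ˢ Set.Icc (-1 : ℝ) 1,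
      f p.1 p.2 * (sphereP m k).eval p.1 * (sphereP M l).eval p.2 *
        (sphereWeight m p.1 * sphereWeight M p.2)

/-- On `[-1,1]²` the function `f` is the sum of the double series `∑ a_{k,l} P_k^m(t) P_l^M(s)`, in
which `a_{k,l} ≥ 0` and `∑ a_{k,l} P_k^m(1) P_l^M(1) < ∞`. -/
def HasSchoenbergExpansion (m M : ℕ) (f : ℝ → ℝ → ℝ) (a : ℕ → ℕ → ℝ) : Prop :=
  (∀ k l, 0 ≤ a k l) ∧
  Summable (fun p : ℕ × ℕ =>
    a p.1 p.2 * (sphereP m p.1).eval 1 * (sphereP M p.2).eval 1) ∧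
  ∀ t ∈ Set.Icc (-1 : ℝ) 1, ∀ s ∈ Set.Icc (-1 : ℝ) 1,
    HasSum (fun p : ℕ × ℕ =>
      a p.1 p.2 * (sphereP m p.1).eval t * (sphereP M p.2).eval s) (f t s)

/-! Everything rests on the reproducing formula `integral_sphereP_convolution`: integrating P_k(x·u)
P_k(u·z) over the sphere gives τ_k / P_k(1) times P_k(x·z). Thus P_k(x·y) is a positive multiple of
a Gram kernel, and multiplying a positive definite kernel by it preserves positive definiteness
(`IsPosDefKernel.mul_integral`). Every term of a Schoenberg series is therefore positive definite,
and so is the sum; this is the sufficiency.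

The formula itself follows from orthogonality. The surface measure is rotation invariant and
projects to w_m(t) dt under x ↦ x·y. The convolution of two zonal polynomials is a zonal polynomial
of degree at most that of either factor. The convolution of P_k with itself is orthogonal to all
lower degrees, so it is a multiple of P_k, and x = z fixes the constant.

For the necessity, f is continuous on the square. A continuous positive definite kernel has
nonnegative double integral, which for an isotropic kernel is a positive constant times the weighted
integral of f. Applied to K times P_k P_l, this makes every Fourier coefficient nonnegative. For
summability, f is tested against powers of ((1+t)/2)((1+s)/2). These are positive definite
polynomials concentrating at (1,1), so Parseval is a finite sum of nonnegative terms, and in the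
limit the partial sums of the series at (1,1) are bounded by sup |f| (`sum_squareCoeff_le`). Since
|P_k| ≤ P_k(1), the series converges uniformly; its sum has the same coefficients as f, and
Stone–Weierstrass makes the two equal. -/

open MeasureTheory
open scoped Pointwise

/-! ### Algebra of the polynomials P_k: differential equation, degree, value at 1 -/

open Polynomial in
theorem gegenbauer_recurrence (a : ℝ) (k : ℕ) :
    ((k : ℝ[X]) + 2) * gegenbauer a (k + 2) =
      2 * ((k : ℝ[X]) + 1 + C a) * X * gegenbauer a (k + 1)
        - ((k : ℝ[X]) + 2 * C a) * gegenbauer a k := by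
  have hk : (k : ℝ) + 2 ≠ 0 := by positivity
  have h1 : ((k : ℝ[X]) + 2) * C (2 * ((k : ℝ) + 1 + a) / ((k : ℝ) + 2)) =
      2 * ((k : ℝ[X]) + 1 + C a) := by
    have : ((k : ℝ[X]) + 2) = C ((k : ℝ) + 2) := by simp [C_ofNat]
    rw [this, ← C_mul, mul_div_cancel₀ _ hk]
    simp [C_ofNat]
  have h2 : ((k : ℝ[X]) + 2) * C (((k : ℝ) + 2 * a) / ((k : ℝ) + 2)) =
      (k : ℝ[X]) + 2 * C a := by
    have : ((k : ℝ[X]) + 2) = C ((k : ℝ) + 2) := by simp [C_ofNat]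
    rw [this, ← C_mul, mul_div_cancel₀ _ hk]
    simp [C_ofNat]
  rw [gegenbauer]
  linear_combination X * gegenbauer a (k + 1) * h1 - gegenbauer a k * h2

-- The two first-order relations are carried through the induction together: at each step both
-- follow from the recurrence, its derivative and the two preceding relations.
open Polynomial in
theorem gegenbauer_derivative_relations (a : ℝ) (k : ℕ) :
    (1 - X ^ 2) * derivative (gegenbauer a (k + 1)) =
        -(((k : ℝ[X]) + 1) * X * gegenbauer a (k + 1)) + ((k : ℝ[X]) + 2 * C a) * gegenbauer a k ∧
      ((k : ℝ[X]) + 1) * gegenbauer a (k + 1) =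
        X * derivative (gegenbauer a (k + 1)) - derivative (gegenbauer a k) := by
  induction k with
  | zero =>
    simp only [gegenbauer, derivative_mul, derivative_C, derivative_X, derivative_one]
    have : (C (2 * a) : ℝ[X]) = 2 * C a := by simp [C_ofNat]
    rw [this]
    constructor <;> push_cast <;> ring
  | succ k ih =>
    obtain ⟨h1, h2⟩ := ih
    have hr := gegenbauer_recurrence a k
    have hd := congrArg derivative hr
    simp only [derivative_mul, derivative_sub, derivative_add, derivative_natCast,
      derivative_ofNat, derivative_C, derivative_X, derivative_one] at hd
    have hk : ((k : ℝ[X]) + 2) ≠ 0 := by exact_mod_cast (by omega : k + 2 ≠ 0)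
    have hI2 : (((k + 1 : ℕ) : ℝ[X]) + 1) * gegenbauer a (k + 1 + 1) =
        X * derivative (gegenbauer a (k + 1 + 1)) - derivative (gegenbauer a (k + 1)) := by
      apply mul_left_cancel₀ hk
      push_cast
      linear_combination ((k : ℝ[X]) + 2) * hr - X * hd + ((k : ℝ[X]) + 2 * C a) * X * h2
        + ((k : ℝ[X]) + 2) * h1
    refine ⟨?_, hI2⟩
    apply mul_left_cancel₀ hk
    push_cast at hI2 ⊢
    linear_combination (1 - X ^ 2) * hd + ((k : ℝ[X]) + 2) * X * hr
      - ((k : ℝ[X]) + 2 * C a) * (1 - X ^ 2) * h2 + ((k : ℝ[X]) + 2) * X * h1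

-- Differentiate the first of the first-order relations and eliminate the derivative of the lower
-- polynomial by the second.
open Polynomial in
theorem gegenbauer_differential_equation (a : ℝ) (k : ℕ) :
    (1 - X ^ 2) * derivative (derivative (gegenbauer a k)) =
      (2 * C a + 1) * X * derivative (gegenbauer a k)
        - (k : ℝ[X]) * ((k : ℝ[X]) + 2 * C a) * gegenbauer a k := by
  cases k with
  | zero => simp [gegenbauer]
  | succ k =>
    obtain ⟨h1, h2⟩ := gegenbauer_derivative_relations a k
    have hd := congrArg derivative h1
    simp only [derivative_mul, derivative_sub, derivative_add, derivative_natCast, derivative_neg,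
      derivative_ofNat, derivative_C, derivative_X, derivative_one, derivative_X_pow] at hd
    push_cast at hd ⊢
    simp only [map_ofNat] at hd
    linear_combination hd + ((k : ℝ[X]) + 2 * C a) * h2

open Polynomial in
theorem gegenbauer_natDegree_le_and_coeff_pos {a : ℝ} (ha : 0 < a) (k : ℕ) :
    (gegenbauer a k).natDegree ≤ k ∧ 0 < (gegenbauer a k).coeff k := by
  induction k using Nat.twoStepInduction with
  | zero => simp [gegenbauer]
  | one =>
    refine ⟨(natDegree_C_mul_le _ _).trans natDegree_X_le, ?_⟩
    simp only [gegenbauer, coeff_C_mul, coeff_X_one]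
    positivity
  | more k ih0 ih1 =>
    constructor
    · rw [gegenbauer]
      refine (natDegree_sub_le _ _).trans (max_le ?_ ?_)
      · refine natDegree_mul_le.trans ?_
        have := (natDegree_C_mul_le (2 * ((k : ℝ) + 1 + a) / ((k : ℝ) + 2)) X).trans natDegree_X_le
        omega
      · refine (natDegree_C_mul_le _ _).trans ?_
        omega
    · rw [gegenbauer, coeff_sub, mul_assoc, coeff_C_mul, coeff_X_mul, coeff_C_mul,
        coeff_eq_zero_of_natDegree_lt (p := gegenbauer a k) (by omega), mul_zero, sub_zero]
      have := ih1.2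
      positivity

theorem gegenbauer_eval_one_succ (a : ℝ) (k : ℕ) :
    ((k : ℝ) + 1) * (gegenbauer a (k + 1)).eval 1 = (k + 2 * a) * (gegenbauer a k).eval 1 := by
  have h := congrArg (Polynomial.eval 1) (gegenbauer_derivative_relations a k).1
  simp at h
  linarith

theorem gegenbauer_eval_one_pos {a : ℝ} (ha : 0 < a) (k : ℕ) : 0 < (gegenbauer a k).eval 1 := by
  induction k with
  | zero => simp [gegenbauer]
  | succ k ih =>
    have h := gegenbauer_eval_one_succ a k
    have : 0 < ((k : ℝ) + 1) * (gegenbauer a (k + 1)).eval 1 := by rw [h]; positivity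
    exact pos_of_mul_pos_right this (by positivity)

-- The Chebyshev and Gegenbauer cases share one equation with eigenvalue k(k+m-1), so orthogonality
-- needs no case distinction on m.
open Polynomial in
theorem sphereP_differential_equation {m : ℕ} (hm : 1 ≤ m) (k : ℕ) :
    (1 - X ^ 2) * derivative (derivative (sphereP m k)) =
      (m : ℝ[X]) * X * derivative (sphereP m k)
        - C ((k : ℝ) * (k + m - 1)) * sphereP m k := by
  unfold sphereP
  split_ifs with h
  · subst h
    have := Chebyshev.one_sub_X_sq_mul_derivative_derivative_T_eq_poly_in_T (R := ℝ) (k : ℤ)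
    simp only [Function.iterate_succ, Function.iterate_zero, Function.comp_apply, id] at this
    rw [this]
    simp [sq]
  · rw [gegenbauer_differential_equation]
    have h1 : (2 * C (((m : ℝ) - 1) / 2) : ℝ[X]) = m - 1 := by
      rw [← C_ofNat, ← C_mul, mul_div_cancel₀ _ two_ne_zero]; simp
    have h2 : (C ((k : ℝ) * (k + m - 1)) : ℝ[X]) = k * (k + m - 1) := by simp
    rw [h1, h2]
    ring

theorem sphereP_parameter_pos {m : ℕ} (hm : 1 ≤ m) (h : m ≠ 1) : 0 < ((m : ℝ) - 1) / 2 := by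
  have : (2 : ℝ) ≤ m := by exact_mod_cast (by omega : 2 ≤ m)
  linarith

theorem sphereP_natDegree {m : ℕ} (hm : 1 ≤ m) (k : ℕ) : (sphereP m k).natDegree = k := by
  unfold sphereP
  split_ifs with h
  · simp
  · obtain ⟨h1, h2⟩ := gegenbauer_natDegree_le_and_coeff_pos (sphereP_parameter_pos hm h) k
    exact le_antisymm h1 (Polynomial.le_natDegree_of_ne_zero h2.ne')

theorem sphereP_eval_one_pos {m : ℕ} (hm : 1 ≤ m) (k : ℕ) : 0 < (sphereP m k).eval 1 := by
  unfold sphereP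
  split_ifs with h
  · simp
  · exact gegenbauer_eval_one_pos (sphereP_parameter_pos hm h) k

theorem sphereP_ne_zero {m : ℕ} (hm : 1 ≤ m) (k : ℕ) : sphereP m k ≠ 0 := fun h => by
  simpa [h] using sphereP_eval_one_pos hm k

open Polynomial in
theorem exists_natDegree_sub_C_mul_sphereP_lt {m : ℕ} (hm : 1 ≤ m) {n : ℕ} {p : ℝ[X]}
    (hp : p.degree < (n + 1 : ℕ)) : ∃ c : ℝ, (p - C c * sphereP m n).degree < n := by
  have hl : (sphereP m n).coeff n ≠ 0 := by
    have := leadingCoeff_ne_zero.2 (sphereP_ne_zero hm n)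
    rwa [leadingCoeff, sphereP_natDegree hm] at this
  refine ⟨p.coeff n / (sphereP m n).coeff n, ?_⟩
  rw [degree_lt_iff_coeff_zero] at hp ⊢
  intro i hi
  rcases hi.eq_or_lt with rfl | hi
  · rw [coeff_sub, coeff_C_mul, div_mul_cancel₀ _ hl, sub_self]
  · rw [coeff_sub, coeff_C_mul, hp i hi,
      coeff_eq_zero_of_natDegree_lt (p := sphereP m n) (n := i) (by rwa [sphereP_natDegree hm]),
      mul_zero, sub_zero]

open Polynomial in
/-- Every polynomial of degree `< n` is a combination of `P_0, …, P_{n-1}`. -/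
theorem exists_eq_sum_sphereP {m : ℕ} (hm : 1 ≤ m) (n : ℕ) (p : ℝ[X]) (hp : p.degree < n) :
    ∃ b : ℕ → ℝ, p = ∑ k ∈ Finset.range n, C (b k) * sphereP m k := by
  induction n generalizing p with
  | zero =>
    refine ⟨0, ?_⟩
    simpa [Nat.WithBot.lt_zero_iff] using hp
  | succ n ih =>
    obtain ⟨c, hc⟩ := exists_natDegree_sub_C_mul_sphereP_lt hm hp
    obtain ⟨b, hb⟩ := ih _ hc
    refine ⟨Function.update b n c, ?_⟩
    rw [Finset.sum_range_succ, Function.update_self, ← sub_eq_iff_eq_add, hb]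
    refine Finset.sum_congr rfl fun k hk => ?_
    rw [Function.update_of_ne (Finset.mem_range.1 hk).ne]

/-! ### The weighted measure on [-1,1] and orthogonality of the P_k -/

/-- The interval `[-1,1]` as a type. -/
abbrev Seg : Type := Set.Icc (-1 : ℝ) 1

/-- The measure `(1-t²)^((m-2)/2) dt` on `[-1,1]`. -/
noncomputable def gegenbauerMeasure (m : ℕ) : Measure Seg :=
  ((volume : Measure ℝ).comap (Subtype.val : Seg → ℝ)).withDensity fun t =>
    ENNReal.ofReal (sphereWeight m t)

theorem sphereWeight_nonneg (m : ℕ) {t : ℝ} (ht : t ∈ Set.Icc (-1 : ℝ) 1) :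
    0 ≤ sphereWeight m t :=
  Real.rpow_nonneg (by nlinarith [ht.1, ht.2]) _

theorem sphereWeight_pos (m : ℕ) {t : ℝ} (ht : t ∈ Set.Ioo (-1 : ℝ) 1) :
    0 < sphereWeight m t :=
  Real.rpow_pos_of_pos (by nlinarith [ht.1, ht.2]) _

@[fun_prop]
theorem measurable_sphereWeight (m : ℕ) : Measurable (sphereWeight m) := by
  unfold sphereWeight
  fun_prop

/-- Under t = cos θ the weight becomes sin^(m-1) θ dθ, which is bounded even for m = 1, where the
weight blows up at ±1. -/
theorem sin_mul_sphereWeight_cos {m : ℕ} (hm : 1 ≤ m) {θ : ℝ} (hθ : θ ∈ Set.Ioo 0 Real.pi) :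
    Real.sin θ * sphereWeight m (Real.cos θ) = Real.sin θ ^ (m - 1) := by
  have hs : 0 < Real.sin θ := Real.sin_pos_of_pos_of_lt_pi hθ.1 hθ.2
  rw [sphereWeight, ← Real.sin_sq, ← Real.rpow_natCast (Real.sin θ) 2, ← Real.rpow_mul hs.le,
    ← Real.rpow_natCast _ (m - 1)]
  nth_rewrite 1 [← Real.rpow_one (Real.sin θ)]
  rw [← Real.rpow_add hs, Nat.cast_sub hm]
  congr 1
  push_cast
  ring

theorem cos_image_Ioo : Real.cos '' Set.Ioo 0 Real.pi = Set.Ioo (-1) 1 := by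
  ext t
  constructor
  · rintro ⟨θ, hθ, rfl⟩
    constructor
    · rw [← Real.cos_pi]
      exact Real.cos_lt_cos_of_nonneg_of_le_pi hθ.1.le le_rfl hθ.2
    · rw [← Real.cos_zero]
      exact Real.cos_lt_cos_of_nonneg_of_le_pi le_rfl hθ.2.le hθ.1
  · intro ht
    exact ⟨Real.arccos t, ⟨Real.arccos_pos.2 ht.2, Real.arccos_lt_pi.2 ht.1⟩,
      Real.cos_arccos ht.1.le ht.2.le⟩

theorem lintegral_gegenbauerMeasure {m : ℕ} (hm : 1 ≤ m) {g : ℝ → ENNReal} (hg : Measurable g) :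
    ∫⁻ t : Seg, g t ∂gegenbauerMeasure m =
      ∫⁻ θ in Set.Ioo 0 Real.pi, ENNReal.ofReal (Real.sin θ ^ (m - 1)) * g (Real.cos θ) := by
  rw [gegenbauerMeasure, lintegral_withDensity_eq_lintegral_mul _ (by fun_prop) (by fun_prop)]
  refine (lintegral_subtype_comap measurableSet_Icc
    (fun t : ℝ => ENNReal.ofReal (sphereWeight m t) * g t)).trans ?_
  rw [← restrict_Ioo_eq_restrict_Icc, ← cos_image_Ioo,
    lintegral_image_eq_lintegral_abs_deriv_mul measurableSet_Ioo
      (fun θ _ => (Real.hasDerivAt_cos θ).hasDerivWithinAt)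
      (Real.injOn_cos.mono Set.Ioo_subset_Icc_self)]
  refine setLIntegral_congr_fun measurableSet_Ioo fun θ hθ => ?_
  have hs : 0 < Real.sin θ := Real.sin_pos_of_pos_of_lt_pi hθ.1 hθ.2
  rw [abs_neg, abs_of_pos hs, ← mul_assoc, ← ENNReal.ofReal_mul hs.le,
    sin_mul_sphereWeight_cos hm hθ]

theorem isFiniteMeasure_gegenbauerMeasure {m : ℕ} (hm : 1 ≤ m) :
    IsFiniteMeasure (gegenbauerMeasure m) := by
  refine ⟨?_⟩
  have h := lintegral_gegenbauerMeasure hm (g := fun _ => 1) measurable_const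
  rw [lintegral_one] at h
  rw [h]
  calc _ ≤ ∫⁻ θ in Set.Ioo 0 Real.pi, 1 := by
        refine lintegral_mono fun θ => ?_
        rw [mul_one, ENNReal.ofReal_le_one]
        exact (le_abs_self _).trans (by
          rw [abs_pow]; exact pow_le_one₀ (abs_nonneg _) (Real.abs_sin_le_one θ))
    _ < ⊤ := by simp

theorem isOpenPosMeasure_gegenbauerMeasure (m : ℕ) :
    (gegenbauerMeasure m).IsOpenPosMeasure := by
  refine ⟨fun U hU hne h0 => ?_⟩
  obtain ⟨V, hV, rfl⟩ := isOpen_induced_iff.1 hU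
  obtain ⟨⟨t, ht⟩, htV⟩ := hne
  -- The weight may vanish at ±1, so the open set is first shown to meet the open interval.
  have hcl : t ∈ closure (Set.Ioo (-1 : ℝ) 1) := by
    rwa [closure_Ioo (by norm_num)]
  obtain ⟨s, hsV, hs⟩ := mem_closure_iff.1 hcl V hV htV
  have hpos : 0 < volume (V ∩ Set.Ioo (-1 : ℝ) 1) :=
    (hV.inter isOpen_Ioo).measure_pos _ ⟨s, hsV, hs⟩
  rw [gegenbauerMeasure, withDensity_apply_eq_zero (by fun_prop),
    comap_subtype_coe_apply measurableSet_Icc] at h0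
  refine hpos.ne' (measure_mono_null ?_ h0)
  rintro r ⟨hrV, hr⟩
  refine ⟨⟨r, Set.Ioo_subset_Icc_self hr⟩, ⟨?_, hrV⟩, rfl⟩
  simpa using sphereWeight_pos m hr

theorem map_val_gegenbauerMeasure {m : ℕ} (hm : 1 ≤ m) :
    (gegenbauerMeasure m).map Subtype.val =
      ((volume.restrict (Set.Ioo 0 Real.pi)).withDensity
        fun θ => ENNReal.ofReal (Real.sin θ ^ (m - 1))).map Real.cos := by
  refine Measure.ext_of_lintegral _ fun g hg => ?_
  rw [lintegral_map hg measurable_subtype_coe, lintegral_gegenbauerMeasure hm hg,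
    lintegral_map hg Real.measurable_cos,
    lintegral_withDensity_eq_lintegral_mul _ (by fun_prop) (by fun_prop)]
  rfl

theorem integral_gegenbauerMeasure {m : ℕ} (hm : 1 ≤ m) {g : ℝ → ℝ} (hg : Continuous g) :
    ∫ t : Seg, g t ∂gegenbauerMeasure m =
      ∫ θ in (0)..Real.pi, Real.sin θ ^ (m - 1) * g (Real.cos θ) := by
  rw [← integral_map (φ := Subtype.val) (by fun_prop) (by fun_prop), map_val_gegenbauerMeasure hm,
    integral_map (by fun_prop) (by fun_prop),
    integral_withDensity_eq_integral_toReal_smul (by fun_prop) (by simp),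
    intervalIntegral.integral_of_le Real.pi_pos.le, restrict_Ioo_eq_restrict_Ioc]
  refine setIntegral_congr_fun measurableSet_Ioc fun θ hθ => ?_
  rw [ENNReal.toReal_ofReal (pow_nonneg (Real.sin_nonneg_of_nonneg_of_le_pi hθ.1.le hθ.2) _),
    smul_eq_mul]

theorem setIntegral_mul_sphereWeight (m : ℕ) (g : ℝ → ℝ) :
    ∫ t in Set.Icc (-1 : ℝ) 1, g t * sphereWeight m t = ∫ t : Seg, g t ∂gegenbauerMeasure m := by
  rw [gegenbauerMeasure, integral_withDensity_eq_integral_toReal_smul (by fun_prop) (by simp),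
    ← integral_subtype_comap measurableSet_Icc]
  refine integral_congr_ae (Filter.Eventually.of_forall fun t => ?_)
  simp only
  rw [ENNReal.toReal_ofReal (sphereWeight_nonneg m t.2), smul_eq_mul, mul_comm]

theorem sphereNormSq_eq (m k : ℕ) :
    sphereNormSq m k = ∫ t : Seg, (sphereP m k).eval (t : ℝ) ^ 2 ∂gegenbauerMeasure m :=
  setIntegral_mul_sphereWeight m _

theorem integrable_of_continuous_compact {X : Type*} [TopologicalSpace X] [CompactSpace X]
    [MeasurableSpace X] [OpensMeasurableSpace X] {μ : Measure X} [IsFiniteMeasure μ]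
    {g : X → ℝ} (hg : Continuous g) : Integrable g μ :=
  hg.integrable_of_hasCompactSupport (HasCompactSupport.of_compactSpace g)

-- Times the weight, the integrand is the derivative of (1-t²)^(m/2) F, which vanishes at ±1. The
-- antiderivative is written in the variable θ to avoid the endpoint singularities.
open Polynomial in
theorem integral_gegenbauerMeasure_divergence {m : ℕ} (hm : 1 ≤ m) (F : ℝ[X]) :
    ∫ t : Seg, ((1 - X ^ 2) * derivative F - (m : ℝ[X]) * X * F).eval (t : ℝ)
      ∂gegenbauerMeasure m = 0 := by
  rw [integral_gegenbauerMeasure hm (g := fun t => eval t _) (Polynomial.continuous _)]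
  have hd : ∀ θ ∈ Set.uIcc 0 Real.pi, HasDerivAt
      (fun θ => -(Real.sin θ ^ m * F.eval (Real.cos θ)))
      (Real.sin θ ^ (m - 1) *
        ((1 - X ^ 2) * derivative F - (m : ℝ[X]) * X * F).eval (Real.cos θ)) θ := by
    intro θ _
    have h := (((Real.hasDerivAt_sin θ).pow m).mul
      ((F.hasDerivAt (Real.cos θ)).comp θ (Real.hasDerivAt_cos θ))).neg
    refine h.congr_deriv ?_
    simp only [eval_sub, eval_mul, eval_one, eval_pow, eval_X, eval_natCast, Pi.pow_apply,
      Function.comp_apply]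
    rw [← Real.sin_sq]
    obtain ⟨n, rfl⟩ : ∃ n, m = n + 1 := ⟨m - 1, by omega⟩
    simp only [Nat.add_sub_cancel]
    ring
  rw [intervalIntegral.integral_eq_sub_of_hasDerivAt hd]
  · simp [show m ≠ 0 by omega]
  · apply Continuous.intervalIntegrable
    fun_prop

-- Sturm–Liouville argument: the divergence identity is applied to the Wronskian of P_k and P_l, and
-- the differential equations leave the difference of the eigenvalues times P_k P_l.
open Polynomial in
theorem integral_sphereP_mul_sphereP {m : ℕ} (hm : 1 ≤ m) {k l : ℕ} (hkl : k ≠ l) :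
    ∫ t : Seg, (sphereP m k).eval (t : ℝ) * (sphereP m l).eval (t : ℝ) ∂gegenbauerMeasure m
      = 0 := by
  have h := integral_gegenbauerMeasure_divergence hm
    (derivative (sphereP m k) * sphereP m l - sphereP m k * derivative (sphereP m l))
  set c : ℝ := (l : ℝ) * (l + m - 1) - (k : ℝ) * (k + m - 1) with hc
  have he : (1 - X ^ 2) * derivative (derivative (sphereP m k) * sphereP m l
        - sphereP m k * derivative (sphereP m l)) - (m : ℝ[X]) * X *
        (derivative (sphereP m k) * sphereP m l - sphereP m k * derivative (sphereP m l)) =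
      C c * (sphereP m k * sphereP m l) := by
    simp only [derivative_sub, derivative_mul, hc, C_sub]
    linear_combination sphereP m l * sphereP_differential_equation hm k
      - sphereP m k * sphereP_differential_equation hm l
  rw [he] at h
  simp only [eval_mul, eval_C, integral_const_mul] at h
  refine (mul_eq_zero.1 h).resolve_left ?_
  have : c = ((l : ℝ) - k) * (l + k + (m - 1)) := by rw [hc]; ring
  rw [this]
  have hm' : (1 : ℝ) ≤ m := by exact_mod_cast hm
  refine mul_ne_zero (sub_ne_zero.2 (by exact_mod_cast hkl.symm)) (ne_of_gt ?_)
  -- For m = 1 the second factor is just l + k, positive because k ≠ l.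
  have : (1 : ℝ) ≤ (l : ℝ) + k := by exact_mod_cast (by omega : 1 ≤ l + k)
  linarith

open Polynomial in
theorem integral_sphereP_mul_of_degree_lt {m : ℕ} (hm : 1 ≤ m) {k : ℕ} {q : ℝ[X]}
    (hq : q.degree < k) :
    ∫ t : Seg, (sphereP m k).eval (t : ℝ) * q.eval (t : ℝ) ∂gegenbauerMeasure m = 0 := by
  have := isFiniteMeasure_gegenbauerMeasure hm
  obtain ⟨b, hb⟩ := exists_eq_sum_sphereP hm k q hq
  rw [hb]
  simp only [eval_finsetSum, eval_mul, eval_C, Finset.mul_sum]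
  rw [integral_finsetSum]
  · refine Finset.sum_eq_zero fun i hi => ?_
    simp only [mul_left_comm _ (b i)]
    rw [integral_const_mul, integral_sphereP_mul_sphereP hm (Finset.mem_range.1 hi).ne', mul_zero]
  · intro i _
    exact integrable_of_continuous_compact (by fun_prop)

open Polynomial in
theorem eq_zero_of_integral_sq_gegenbauerMeasure {m : ℕ} (hm : 1 ≤ m) {q : ℝ[X]}
    (hq : ∫ t : Seg, q.eval (t : ℝ) ^ 2 ∂gegenbauerMeasure m = 0) : q = 0 := by
  have := isFiniteMeasure_gegenbauerMeasure hm
  have := isOpenPosMeasure_gegenbauerMeasure m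
  have hc : Continuous fun t : Seg => q.eval (t : ℝ) ^ 2 := by fun_prop
  rw [integral_eq_zero_iff_of_nonneg (fun t => sq_nonneg _) (integrable_of_continuous_compact hc),
    hc.ae_eq_iff_eq _ continuous_zero] at hq
  refine q.eq_zero_of_infinite_isRoot ((Set.Icc_infinite (show (-1 : ℝ) < 1 by norm_num)).mono ?_)
  intro t ht
  simpa using congrFun hq ⟨t, ht⟩

theorem sphereNormSq_pos {m : ℕ} (hm : 1 ≤ m) (k : ℕ) : 0 < sphereNormSq m k := by
  rw [sphereNormSq_eq]
  refine lt_of_le_of_ne (integral_nonneg fun t => sq_nonneg _) fun h => ?_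
  exact sphereP_ne_zero hm k (eq_zero_of_integral_sq_gegenbauerMeasure hm h.symm)

open Polynomial in
/-- A polynomial of degree at most `k` orthogonal to all polynomials of lower degree is a multiple
of `P_k`. -/
theorem eq_C_mul_sphereP_of_orthogonal {m : ℕ} (hm : 1 ≤ m) {k : ℕ} {h : ℝ[X]}
    (hdeg : h.degree < (k + 1 : ℕ))
    (horth : ∀ q : ℝ[X], q.degree < k →
      ∫ t : Seg, h.eval (t : ℝ) * q.eval (t : ℝ) ∂gegenbauerMeasure m = 0) :
    ∃ c : ℝ, h = C c * sphereP m k := by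
  have := isFiniteMeasure_gegenbauerMeasure hm
  obtain ⟨c, hc⟩ := exists_natDegree_sub_C_mul_sphereP_lt hm hdeg
  refine ⟨c, sub_eq_zero.1 (eq_zero_of_integral_sq_gegenbauerMeasure hm ?_)⟩
  set r := h - C c * sphereP m k with hr
  -- The remainder r has degree below k, so both h and P_k are orthogonal to it, and r has zero
  -- norm.
  have h1 : ∀ t : ℝ, r.eval t ^ 2 =
      h.eval t * r.eval t - c * ((sphereP m k).eval t * r.eval t) := by
    intro t
    nth_rewrite 1 [hr]
    rw [sq, hr]; simp; ring
  simp only [h1]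
  rw [integral_sub (integrable_of_continuous_compact (by fun_prop))
    (integrable_of_continuous_compact (by fun_prop)), integral_const_mul, horth r hc,
    integral_sphereP_mul_of_degree_lt hm hc, mul_zero, sub_zero]

/-! ### Polar coordinates and the surface measure of the sphere -/

theorem lintegral_volumeIoiPow (n : ℕ) {f : ℝ → ENNReal} (hf : Measurable f) :
    ∫⁻ r : Set.Ioi (0 : ℝ), f r ∂Measure.volumeIoiPow n =
      ∫⁻ r in Set.Ioi (0 : ℝ), ENNReal.ofReal (r ^ n) * f r := by
  rw [Measure.volumeIoiPow, lintegral_withDensity_eq_lintegral_mul _ (by fun_prop) (by fun_prop)]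
  exact lintegral_subtype_comap measurableSet_Ioi (fun r : ℝ => ENNReal.ofReal (r ^ n) * f r)

section Polar

variable {E : Type*} [NormedAddCommGroup E] [NormedSpace ℝ E] [Nontrivial E]
  [MeasurableSpace E] [BorelSpace E] [FiniteDimensional ℝ E]
  (μ : Measure E) [μ.IsAddHaarMeasure]

theorem lintegral_eq_lintegral_toSphere {G : E → ENNReal} (hG : Measurable G) :
    ∫⁻ x, G x ∂μ = ∫⁻ u, ∫⁻ r : Set.Ioi (0 : ℝ), G ((r : ℝ) • (u : E))
      ∂Measure.volumeIoiPow (Module.finrank ℝ E - 1) ∂μ.toSphere := by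
  have h0 : ∫⁻ x, G x ∂μ = ∫⁻ x : ({0}ᶜ : Set E), G x ∂(μ.comap Subtype.val) := by
    rw [lintegral_subtype_comap (measurableSet_singleton _).compl,
      restrict_compl_singleton]
  have h1 := (μ.measurePreserving_homeomorphUnitSphereProd).lintegral_comp_emb
    (Homeomorph.measurableEmbedding _)
    (fun p : Metric.sphere (0 : E) 1 × Set.Ioi (0 : ℝ) => G ((p.2 : ℝ) • (p.1 : E)))
  have h2 : Measurable fun p : Metric.sphere (0 : E) 1 × Set.Ioi (0 : ℝ) =>
      G ((p.2 : ℝ) • (p.1 : E)) := by fun_prop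
  rw [h0, ← lintegral_prod (fun p : Metric.sphere (0 : E) 1 × Set.Ioi (0 : ℝ) =>
      G ((p.2 : ℝ) • (p.1 : E))) h2.aemeasurable, ← h1]
  refine lintegral_congr fun x => ?_
  have hx : ‖(x : E)‖ ≠ 0 := norm_ne_zero_iff.2 x.2
  simp [smul_smul, hx]

theorem lintegral_comp_norm {f : ℝ → ENNReal} (hf : Measurable f) :
    ∫⁻ x, f ‖x‖ ∂μ = μ.toSphere Set.univ *
      ∫⁻ r in Set.Ioi (0 : ℝ), ENNReal.ofReal (r ^ (Module.finrank ℝ E - 1)) * f r := by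
  rw [lintegral_eq_lintegral_toSphere μ (G := fun x => f ‖x‖) (hf.comp measurable_norm),
    ← lintegral_volumeIoiPow _ hf]
  have : ∀ u : Metric.sphere (0 : E) 1, ∀ r : Set.Ioi (0 : ℝ), ‖(r : ℝ) • (u : E)‖ = r := by
    intro u r
    rw [norm_smul, norm_eq_of_mem_sphere, mul_one, Real.norm_of_nonneg (le_of_lt r.2)]
  simp only [this, lintegral_const]
  rw [mul_comm]

end Polar

/-- The surface measure of a set is, up to a constant, the volume of the cone over it, and a linear
isometry commutes with forming cones. -/
theorem toSphere_map_linearIsometryEquiv {E : Type*} [NormedAddCommGroup E] [NormedSpace ℝ E]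
    [MeasurableSpace E] [BorelSpace E] (μ : Measure E) (R : E ≃ₗᵢ[ℝ] E)
    (hR : MeasurePreserving R μ μ) :
    (μ.toSphere.map Subtype.val).map R = μ.toSphere.map Subtype.val := by
  ext s hs
  have hRs : MeasurableSet (R ⁻¹' s) := R.continuous.measurable hs
  rw [Measure.map_apply R.continuous.measurable hs, Measure.map_apply measurable_subtype_coe hRs,
    Measure.map_apply measurable_subtype_coe hs,
    Measure.toSphere_apply' _ (measurable_subtype_coe hRs),
    Measure.toSphere_apply' _ (measurable_subtype_coe hs)]
  have hset : (Set.Ioo (0 : ℝ) 1 • (Subtype.val '' (Subtype.val ⁻¹' (R ⁻¹' s) :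
      Set (Metric.sphere (0 : E) 1))) : Set E) = R ⁻¹' (Set.Ioo (0 : ℝ) 1 •
      (Subtype.val '' (Subtype.val ⁻¹' s : Set (Metric.sphere (0 : E) 1)))) := by
    ext x
    simp only [Subtype.image_preimage_coe, Set.mem_smul, Set.mem_inter_iff, Set.mem_preimage,
      mem_sphere_zero_iff_norm]
    constructor
    · rintro ⟨r, hr, y, ⟨hy, hys⟩, rfl⟩
      exact ⟨r, hr, R y, ⟨by simpa using hy, hys⟩, by simp⟩
    · rintro ⟨r, hr, y, ⟨hy, hys⟩, h⟩
      refine ⟨r, hr, R.symm y, ⟨by simpa using hy, by simpa using hys⟩, ?_⟩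
      rw [← map_smul, h, R.symm_apply_apply]
  rw [hset, hR.measure_preimage_emb (R.toHomeomorph.measurableEmbedding)]

theorem measurePreserving_euclidean_cons (m : ℕ) :
    MeasurePreserving (fun p : ℝ × EuclideanSpace ℝ (Fin m) =>
      (WithLp.toLp 2 (Fin.cons p.1 (WithLp.ofLp p.2)) : EuclideanSpace ℝ (Fin (m + 1)))) := by
  have h1 := (PiLp.volume_preserving_toLp (Fin (m + 1))).comp
    (volume_preserving_piFinSuccAbove (fun _ : Fin (m + 1) => ℝ) 0).symm
  have h2 := (MeasurePreserving.id (volume : Measure ℝ)).prod (PiLp.volume_preserving_ofLp (Fin m))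
  rw [Measure.volume_eq_prod]
  convert h1.comp h2 using 1
  funext p
  simp [Function.comp_def, MeasurableEquiv.piFinSuccAbove, Fin.insertNthEquiv]

theorem lintegral_euclidean_succ (m : ℕ) {G : EuclideanSpace ℝ (Fin (m + 1)) → ENNReal}
    (hG : Measurable G) :
    ∫⁻ x, G x = ∫⁻ a : ℝ, ∫⁻ y : EuclideanSpace ℝ (Fin m),
      G (WithLp.toLp 2 (Fin.cons a (WithLp.ofLp y))) := by
  have h := measurePreserving_euclidean_cons m
  rw [← h.lintegral_comp hG, Measure.volume_eq_prod, lintegral_prod]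
  exact (hG.comp h.measurable).aemeasurable

/-- Polar coordinates on the half plane. -/
theorem lintegral_halfPlane {H : ℝ × ℝ → ENNReal} (hH : Measurable H) :
    ∫⁻ a : ℝ, ∫⁻ r in Set.Ioi (0 : ℝ), H (a, r) =
      ∫⁻ ρ in Set.Ioi (0 : ℝ), ∫⁻ θ in Set.Ioo 0 Real.pi,
        ENNReal.ofReal ρ * H (ρ * Real.cos θ, ρ * Real.sin θ) := by
  set S : Set (ℝ × ℝ) := Set.univ ×ˢ Set.Ioi 0 with hS
  have hSm : MeasurableSet S := MeasurableSet.univ.prod measurableSet_Ioi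
  have h1 : ∫⁻ a : ℝ, ∫⁻ r in Set.Ioi (0 : ℝ), H (a, r) = ∫⁻ p, S.indicator H p := by
    rw [lintegral_indicator hSm, hS, Measure.volume_eq_prod, ← Measure.prod_restrict,
      Measure.restrict_univ, lintegral_prod _ hH.aemeasurable]
  rw [h1, ← lintegral_comp_polarCoord_symm, polarCoord_target, Measure.volume_eq_prod,
    ← Measure.prod_restrict, lintegral_prod]
  · refine setLIntegral_congr_fun measurableSet_Ioi fun ρ hρ => ?_
    have hρ' : 0 < ρ := hρ
    rw [← lintegral_indicator measurableSet_Ioo, ← lintegral_indicator measurableSet_Ioo]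
    refine lintegral_congr fun θ => ?_
    by_cases hθ : θ ∈ Set.Ioo 0 Real.pi
    · have hθ' : θ ∈ Set.Ioo (-Real.pi) Real.pi := ⟨by linarith [hθ.1, Real.pi_pos], hθ.2⟩
      have hs := Real.sin_pos_of_pos_of_lt_pi hθ.1 hθ.2
      rw [Set.indicator_of_mem hθ, Set.indicator_of_mem hθ', polarCoord_symm_apply,
        Set.indicator_of_mem, smul_eq_mul]
      exact ⟨trivial, mul_pos hρ' hs⟩
    · rw [Set.indicator_of_notMem hθ]
      by_cases hθ' : θ ∈ Set.Ioo (-Real.pi) Real.pi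
      · rw [Set.indicator_of_mem hθ', polarCoord_symm_apply, Set.indicator_of_notMem, smul_zero]
        rintro ⟨-, h⟩
        have hθ0 : θ ≤ 0 := not_lt.1 fun h0 => hθ ⟨h0, hθ'.2⟩
        have : Real.sin θ ≤ 0 := Real.sin_nonpos_of_nonpos_of_neg_pi_le hθ0 hθ'.1.le
        have h' : 0 < ρ * Real.sin θ := h
        nlinarith
      · rw [Set.indicator_of_notMem hθ']
  · refine Measurable.aemeasurable ?_
    have : Measurable (S.indicator H) := hH.indicator hSm
    have h2 : Measurable fun p : ℝ × ℝ => polarCoord.symm p := continuous_polarCoord_symm.measurable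
    have h3 := this.comp h2
    exact (ENNReal.measurable_ofReal.comp measurable_fst).smul h3

theorem nontrivial_euclideanSpace_of_one_le {m : ℕ} (hm : 1 ≤ m) :
    Nontrivial (EuclideanSpace ℝ (Fin m)) := by
  have : Nonempty (Fin m) := ⟨⟨0, hm⟩⟩
  infer_instance

/-- The angular distribution of the surface measure of the sphere. -/
theorem lintegral_toSphere_coord {m : ℕ} (hm : 1 ≤ m) {g : ℝ → ENNReal} (hg : Measurable g) :
    ∫⁻ u : USphere m, g ((u : EuclideanSpace ℝ (Fin (m + 1))) 0)
        ∂(volume : Measure (EuclideanSpace ℝ (Fin (m + 1)))).toSphere =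
      (volume : Measure (EuclideanSpace ℝ (Fin m))).toSphere Set.univ *
        ∫⁻ t : Seg, g t ∂gegenbauerMeasure m := by
  have := nontrivial_euclideanSpace_of_one_le hm
  -- B is the radial integral over the unit ball; being positive and finite, it can be cancelled at
  -- the end.
  set B : ENNReal := ∫⁻ r in Set.Ioi (0 : ℝ), ENNReal.ofReal (r ^ m) *
    (Set.Iio (1 : ℝ)).indicator 1 r with hB
  have hBval : B = ENNReal.ofReal (1 / ((m : ℝ) + 1)) := by
    have := Measure.volumeIoiPow_apply_Iio m ⟨1, Set.mem_Ioi.2 one_pos⟩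
    simp only [one_pow] at this
    rw [← this, hB, ← lintegral_volumeIoiPow m (measurable_one.indicator measurableSet_Iio),
      ← lintegral_indicator_one measurableSet_Iio]
    rfl
  have hB0 : B ≠ 0 := by
    rw [hBval]
    exact (ENNReal.ofReal_pos.2 (by positivity)).ne'
  have hBt : B ≠ ⊤ := by rw [hBval]; exact ENNReal.ofReal_ne_top
  set A : ENNReal := (volume : Measure (EuclideanSpace ℝ (Fin m))).toSphere Set.univ with hA
  have hAt : A ≠ ⊤ := measure_ne_top _ _
  have key : (∫⁻ u : USphere m, g ((u : EuclideanSpace ℝ (Fin (m + 1))) 0)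
        ∂(volume : Measure (EuclideanSpace ℝ (Fin (m + 1)))).toSphere) * B =
      (A * ∫⁻ t : Seg, g t ∂gegenbauerMeasure m) * B := by
    -- The integral of G is computed twice: by polar coordinates in ℝ^(m+1), and by splitting off
    -- the coordinate x₀, taking polar coordinates in the remaining ℝ^m and then in the half plane
    -- of (x₀, radius).
    set G : EuclideanSpace ℝ (Fin (m + 1)) → ENNReal := fun x =>
      (Set.Iio (1 : ℝ)).indicator 1 ‖x‖ * g (x 0 / ‖x‖) with hG
    have hind : Measurable ((Set.Iio (1 : ℝ)).indicator (1 : ℝ → ENNReal)) :=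
      measurable_one.indicator measurableSet_Iio
    have hGm : Measurable G := by
      refine (hind.comp measurable_norm).mul (hg.comp (Measurable.div ?_ measurable_norm))
      exact (EuclideanSpace.proj (𝕜 := ℝ) (0 : Fin (m + 1))).continuous.measurable
    trans ∫⁻ x, G x
    · rw [lintegral_eq_lintegral_toSphere _ hGm, finrank_euclideanSpace_fin, Nat.add_sub_cancel,
        ← lintegral_mul_const' _ _ hBt]
      refine lintegral_congr fun u => ?_
      rw [hB, ← lintegral_volumeIoiPow m hind, ← lintegral_const_mul _ (by fun_prop)]
      refine lintegral_congr fun r => ?_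
      have hr : (0 : ℝ) < r := r.2
      have hn : ‖(r : ℝ) • (u : EuclideanSpace ℝ (Fin (m + 1)))‖ = r := by
        rw [norm_smul, norm_eq_of_mem_sphere, mul_one, Real.norm_of_nonneg hr.le]
      simp only [hG, hn, PiLp.smul_apply, smul_eq_mul]
      rw [mul_div_cancel_left₀ _ hr.ne', mul_comm]
    · set H : ℝ × ℝ → ENNReal := fun p =>
        (Set.Iio (1 : ℝ)).indicator 1 (√(p.1 ^ 2 + p.2 ^ 2)) *
          g (p.1 / √(p.1 ^ 2 + p.2 ^ 2)) with hH
      have hHm : Measurable H := by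
        refine (hind.comp ?_).mul (hg.comp ?_) <;> fun_prop
      have h1 : ∀ a : ℝ, ∀ y : EuclideanSpace ℝ (Fin m),
          G (WithLp.toLp 2 (Fin.cons a (WithLp.ofLp y))) = H (a, ‖y‖) := by
        intro a y
        have : ‖(WithLp.toLp 2 (Fin.cons a (WithLp.ofLp y)) : EuclideanSpace ℝ (Fin (m + 1)))‖ =
            √(a ^ 2 + ‖y‖ ^ 2) := by
          rw [EuclideanSpace.norm_eq, Fin.sum_univ_succ, EuclideanSpace.norm_sq_eq]
          simp
        simp only [hG, hH, this]
        rfl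
      rw [lintegral_euclidean_succ m hGm]
      simp only [h1]
      have h2 : ∀ a : ℝ, ∫⁻ y : EuclideanSpace ℝ (Fin m), H (a, ‖y‖) =
          A * ∫⁻ r in Set.Ioi (0 : ℝ), ENNReal.ofReal (r ^ (m - 1)) * H (a, r) := by
        intro a
        rw [lintegral_comp_norm volume (f := fun r => H (a, r)) (by fun_prop),
          finrank_euclideanSpace_fin]
      simp only [h2]
      rw [lintegral_const_mul' _ _ hAt,
        lintegral_halfPlane (H := fun p => ENNReal.ofReal (p.2 ^ (m - 1)) * H p) (by fun_prop),
        mul_assoc, lintegral_gegenbauerMeasure hm hg, mul_comm _ B, hB,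
        ← lintegral_mul_const _ (by fun_prop)]
      congr 1
      refine setLIntegral_congr_fun measurableSet_Ioi fun ρ hρ => ?_
      have hρ' : 0 < ρ := hρ
      simp only
      rw [← lintegral_const_mul _ (by fun_prop)]
      refine setLIntegral_congr_fun measurableSet_Ioo fun θ hθ => ?_
      have hs := Real.sin_pos_of_pos_of_lt_pi hθ.1 hθ.2
      have hn : √((ρ * Real.cos θ) ^ 2 + (ρ * Real.sin θ) ^ 2) = ρ := by
        rw [mul_pow, mul_pow, ← mul_add, Real.cos_sq_add_sin_sq, mul_one, Real.sqrt_sq hρ'.le]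
      simp only [hH, hn]
      rw [mul_div_cancel_left₀ _ hρ'.ne', mul_pow, ENNReal.ofReal_mul (by positivity)]
      -- One ρ is the planar Jacobian; the others come from the factor (ρ sin θ)^(m-1) of the inner
      -- sphere.
      have : ENNReal.ofReal (ρ ^ m) = ENNReal.ofReal ρ * ENNReal.ofReal (ρ ^ (m - 1)) := by
        rw [← ENNReal.ofReal_mul hρ'.le, ← pow_succ', Nat.sub_add_cancel hm]
      rw [this]
      ring
  exact (ENNReal.mul_left_inj hB0 hBt).1 key

/-- The surface measure of `S^m`, normalized so that `x ↦ x · y` pushes it to the weight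
`(1-t²)^((m-2)/2)` on `[-1,1]`. -/
noncomputable def surfaceMeasure (m : ℕ) : Measure (USphere m) :=
  ((volume : Measure (EuclideanSpace ℝ (Fin m))).toSphere Set.univ)⁻¹ •
    (volume : Measure (EuclideanSpace ℝ (Fin (m + 1)))).toSphere

theorem toSphere_univ_ne_zero {m : ℕ} (hm : 1 ≤ m) :
    (volume : Measure (EuclideanSpace ℝ (Fin m))).toSphere Set.univ ≠ 0 := by
  have := nontrivial_euclideanSpace_of_one_le hm
  rw [Ne, Measure.measure_univ_eq_zero]
  exact Measure.toSphere_ne_zero _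

theorem isFiniteMeasure_surfaceMeasure {m : ℕ} (hm : 1 ≤ m) :
    IsFiniteMeasure (surfaceMeasure m) := by
  refine ⟨?_⟩
  rw [surfaceMeasure, Measure.smul_apply, smul_eq_mul]
  exact ENNReal.mul_lt_top (ENNReal.inv_lt_top.2 (pos_iff_ne_zero.2 (toSphere_univ_ne_zero hm)))
    (measure_lt_top _ _)

theorem integral_surfaceMeasure_comp_isometry {m : ℕ}
    (R : EuclideanSpace ℝ (Fin (m + 1)) ≃ₗᵢ[ℝ] EuclideanSpace ℝ (Fin (m + 1)))
    (F : EuclideanSpace ℝ (Fin (m + 1)) → ℝ) :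
    ∫ u : USphere m, F (R u) ∂surfaceMeasure m = ∫ u : USphere m, F u ∂surfaceMeasure m := by
  have hemb : MeasurableEmbedding (Subtype.val : USphere m → EuclideanSpace ℝ (Fin (m + 1))) :=
    MeasurableEmbedding.subtype_coe Metric.isClosed_sphere.measurableSet
  have hR : MeasurableEmbedding R := R.toHomeomorph.measurableEmbedding
  have h := toSphere_map_linearIsometryEquiv volume R R.measurePreserving
  rw [surfaceMeasure, integral_smul_measure, integral_smul_measure,
    ← hemb.integral_map (fun x => F (R x)), ← hR.integral_map, h, hemb.integral_map]

/-- An orthonormal pair can be moved to the first two coordinates. -/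
theorem exists_isometry_pair {m : ℕ} (hm : 1 ≤ m) {z v : EuclideanSpace ℝ (Fin (m + 1))}
    (hz : ‖z‖ = 1) (hv : ‖v‖ = 1) (hzv : inner ℝ z v = 0) :
    ∃ R : EuclideanSpace ℝ (Fin (m + 1)) ≃ₗᵢ[ℝ] EuclideanSpace ℝ (Fin (m + 1)),
      (∀ u, R u 0 = inner ℝ z u) ∧ ∀ u, R u 1 = inner ℝ v u := by
  have h10 : (1 : Fin (m + 1)) ≠ 0 := by
    obtain ⟨n, rfl⟩ : ∃ n, m = n + 1 := ⟨m - 1, by omega⟩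
    exact Fin.zero_ne_one.symm
  have horth : Orthonormal ℝ ((({0, 1} : Set (Fin (m + 1))).domRestrict
      fun i => if i = 0 then z else v)) := by
    rw [orthonormal_iff_ite]
    rintro ⟨i, rfl | rfl⟩ ⟨j, rfl | rfl⟩ <;>
      simp [Set.domRestrict, h10, hzv, hz, hv, real_inner_comm]
    · exact fun h => h10 (congrArg Subtype.val h).symm
    · exact fun h => h10 (congrArg Subtype.val h)
  obtain ⟨b, hb⟩ := horth.exists_orthonormalBasis_extension_of_card_eq (by simp)
  refine ⟨b.repr, fun u => ?_, fun u => ?_⟩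
  · rw [b.repr_apply_apply, hb 0 (by simp)]; simp
  · rw [b.repr_apply_apply, hb 1 (by simp)]; simp [h10]

theorem exists_unit_orthogonal {m : ℕ} (hm : 1 ≤ m) (z : EuclideanSpace ℝ (Fin (m + 1))) :
    ∃ v : EuclideanSpace ℝ (Fin (m + 1)), ‖v‖ = 1 ∧ inner ℝ z v = 0 := by
  have hlt : Module.finrank ℝ (Submodule.span ℝ {z}) <
      Module.finrank ℝ (EuclideanSpace ℝ (Fin (m + 1))) := by
    have := finrank_span_le_card (R := ℝ) ({z} : Set (EuclideanSpace ℝ (Fin (m + 1))))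
    simp only [Set.toFinset_singleton, Finset.card_singleton] at this
    simp only [finrank_euclideanSpace_fin]
    omega
  have hne : (Submodule.span ℝ {z})ᗮ ≠ ⊥ := by
    intro h
    rw [Submodule.orthogonal_eq_bot_iff] at h
    rw [h, finrank_top] at hlt
    exact lt_irrefl _ hlt
  obtain ⟨w, hw, hw0⟩ := Submodule.exists_mem_ne_zero_of_ne_bot hne
  refine ⟨‖w‖⁻¹ • w, norm_smul_inv_norm hw0, ?_⟩
  rw [inner_smul_right, Submodule.mem_orthogonal_singleton_iff_inner_right.1 hw, mul_zero]

/-! ### Zonal integration on the sphere -/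

/-- The inner product of two points of the sphere, as an element of `[-1,1]`. -/
noncomputable def sphereInner {m : ℕ} (x y : USphere m) : Seg :=
  ⟨inner ℝ (x : EuclideanSpace ℝ (Fin (m + 1))) (y : EuclideanSpace ℝ (Fin (m + 1))), by
    have h := abs_real_inner_le_norm (x : EuclideanSpace ℝ (Fin (m + 1)))
      (y : EuclideanSpace ℝ (Fin (m + 1)))
    rw [norm_eq_of_mem_sphere, norm_eq_of_mem_sphere, mul_one] at h
    exact abs_le.1 h⟩

@[fun_prop]
theorem continuous_sphereInner {m : ℕ} :
    Continuous fun p : USphere m × USphere m => sphereInner p.1 p.2 := by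
  unfold sphereInner
  fun_prop

theorem sphereInner_comm {m : ℕ} (x y : USphere m) : sphereInner x y = sphereInner y x :=
  Subtype.ext (real_inner_comm _ _)

theorem sphereInner_self {m : ℕ} (x : USphere m) :
    sphereInner x x = ⟨1, by norm_num⟩ := by
  refine Subtype.ext ?_
  simp [sphereInner]

/-- By rotation invariance y may be moved to the first coordinate axis, where
`lintegral_toSphere_coord` applies. -/
theorem map_sphereInner_surfaceMeasure {m : ℕ} (hm : 1 ≤ m) (y : USphere m) :
    (surfaceMeasure m).map (fun x => sphereInner x y) = gegenbauerMeasure m := by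
  have hmeas : Measurable fun x => sphereInner x y := by
    have : Continuous fun x => sphereInner x y := by fun_prop
    exact this.measurable
  have hemb : MeasurableEmbedding (Subtype.val : Seg → ℝ) :=
    MeasurableEmbedding.subtype_coe measurableSet_Icc
  obtain ⟨v, hv, hyv⟩ := exists_unit_orthogonal hm (y : EuclideanSpace ℝ (Fin (m + 1)))
  obtain ⟨R, hR0, -⟩ := exists_isometry_pair hm (norm_eq_of_mem_sphere y) hv hyv
  have hS := toSphere_map_linearIsometryEquiv volume R R.measurePreserving
  have hRm : Measurable R := R.continuous.measurable
  have h0 : Measurable fun x : EuclideanSpace ℝ (Fin (m + 1)) => x 0 :=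
    (EuclideanSpace.proj (𝕜 := ℝ) (0 : Fin (m + 1))).continuous.measurable
  refine Measure.ext_of_lintegral _ fun g hg => ?_
  obtain ⟨g', hg', rfl⟩ := hemb.exists_measurable_extend hg fun _ => inferInstance
  rw [lintegral_map hg hmeas]
  have h1 := lintegral_toSphere_coord hm hg'
  rw [← lintegral_map (f := fun x : EuclideanSpace ℝ (Fin (m + 1)) => g' (x 0)) (hg'.comp h0)
    measurable_subtype_coe, ← hS,
    lintegral_map (f := fun x : EuclideanSpace ℝ (Fin (m + 1)) => g' (x 0)) (hg'.comp h0) hRm,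
    lintegral_map (f := fun x : EuclideanSpace ℝ (Fin (m + 1)) => g' (R x 0))
      ((hg'.comp h0).comp hRm) measurable_subtype_coe] at h1
  have h2 : ∀ x : USphere m, (g' ∘ Subtype.val) (sphereInner x y) =
      g' (R (x : EuclideanSpace ℝ (Fin (m + 1))) 0) := by
    intro x
    rw [hR0, real_inner_comm]
    rfl
  simp only [h2]
  rw [surfaceMeasure, lintegral_smul_measure, h1, smul_eq_mul, ← mul_assoc,
    ENNReal.inv_mul_cancel (toSphere_univ_ne_zero hm) (measure_ne_top _ _), one_mul]
  rfl

theorem integral_sphereInner {m : ℕ} (hm : 1 ≤ m) (y : USphere m) {g : Seg → ℝ}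
    (hg : Continuous g) :
    ∫ x, g (sphereInner x y) ∂surfaceMeasure m = ∫ t, g t ∂gegenbauerMeasure m := by
  have hc : Continuous fun x => sphereInner x y := by fun_prop
  rw [← map_sphereInner_surfaceMeasure hm y, integral_map hc.aemeasurable
    hg.aestronglyMeasurable]

theorem integral_pair_surfaceMeasure {m : ℕ} (hm : 1 ≤ m) {z v : EuclideanSpace ℝ (Fin (m + 1))}
    (hz : ‖z‖ = 1) (hv : ‖v‖ = 1) (hzv : inner ℝ z v = 0) (F : ℝ → ℝ → ℝ) :
    ∫ u : USphere m, F (inner ℝ z (u : EuclideanSpace ℝ (Fin (m + 1))))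
        (inner ℝ v (u : EuclideanSpace ℝ (Fin (m + 1)))) ∂surfaceMeasure m =
      ∫ u : USphere m, F ((u : EuclideanSpace ℝ (Fin (m + 1))) 0)
        ((u : EuclideanSpace ℝ (Fin (m + 1))) 1) ∂surfaceMeasure m := by
  obtain ⟨R, hR0, hR1⟩ := exists_isometry_pair hm hz hv hzv
  rw [← integral_surfaceMeasure_comp_isometry R (fun x => F (x 0) (x 1))]
  simp only [hR0, hR1]

/-- The pairs (z, v) and (z, -v) are both orthonormal and so give the same integral. This kills the
odd moments of the second coordinate. -/
theorem integral_coord_neg_surfaceMeasure {m : ℕ} (hm : 1 ≤ m) (F : ℝ → ℝ → ℝ) :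
    ∫ u : USphere m, F ((u : EuclideanSpace ℝ (Fin (m + 1))) 0)
        (-(u : EuclideanSpace ℝ (Fin (m + 1))) 1) ∂surfaceMeasure m =
      ∫ u : USphere m, F ((u : EuclideanSpace ℝ (Fin (m + 1))) 0)
        ((u : EuclideanSpace ℝ (Fin (m + 1))) 1) ∂surfaceMeasure m := by
  obtain ⟨z, hz, -⟩ := exists_unit_orthogonal hm 0
  obtain ⟨v, hv, hzv⟩ := exists_unit_orthogonal hm z
  rw [← integral_pair_surfaceMeasure hm hz hv hzv fun a b => F a (-b),
    ← integral_pair_surfaceMeasure hm hz (v := -v) (by rwa [norm_neg])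
      (by rw [inner_neg_right, hzv, neg_zero]) F]
  simp only [inner_neg_left]

theorem exists_orthogonal_decomposition {m : ℕ} (hm : 1 ≤ m) (x z : USphere m) :
    ∃ v : EuclideanSpace ℝ (Fin (m + 1)), ∃ s : ℝ, ‖v‖ = 1 ∧
      inner ℝ (z : EuclideanSpace ℝ (Fin (m + 1))) v = 0 ∧
      (x : EuclideanSpace ℝ (Fin (m + 1))) =
        (sphereInner x z : ℝ) • (z : EuclideanSpace ℝ (Fin (m + 1))) + s • v ∧
      s ^ 2 = 1 - (sphereInner x z : ℝ) ^ 2 := by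
  set t : ℝ := (sphereInner x z : ℝ) with ht
  have ht' : inner ℝ (z : EuclideanSpace ℝ (Fin (m + 1))) (x : EuclideanSpace ℝ (Fin (m + 1))) = t :=
    real_inner_comm _ _
  set w : EuclideanSpace ℝ (Fin (m + 1)) :=
    (x : EuclideanSpace ℝ (Fin (m + 1))) - t • (z : EuclideanSpace ℝ (Fin (m + 1))) with hw
  have hzw : inner ℝ (z : EuclideanSpace ℝ (Fin (m + 1))) w = 0 := by
    rw [hw, inner_sub_right, inner_smul_right, ht', real_inner_self_eq_norm_sq,
      norm_eq_of_mem_sphere]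
    ring
  have hx : (x : EuclideanSpace ℝ (Fin (m + 1))) = t • (z : EuclideanSpace ℝ (Fin (m + 1))) + w := by
    rw [hw]; abel
  have hn : ‖w‖ ^ 2 = 1 - t ^ 2 := by
    have h1 : ‖(x : EuclideanSpace ℝ (Fin (m + 1)))‖ ^ 2 = t ^ 2 + ‖w‖ ^ 2 := by
      rw [hx, norm_add_sq_real, inner_smul_left, hzw, norm_smul, norm_eq_of_mem_sphere]
      simp
    rw [norm_eq_of_mem_sphere] at h1
    linarith
  -- If x = ±z the direction v is undetermined; any unit vector orthogonal to z serves, with s = 0.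
  by_cases hw0 : w = 0
  · obtain ⟨v, hv, hzv⟩ := exists_unit_orthogonal hm (z : EuclideanSpace ℝ (Fin (m + 1)))
    refine ⟨v, 0, hv, hzv, by rw [zero_smul, hx, hw0], ?_⟩
    rw [← hn, hw0, norm_zero]
  · refine ⟨‖w‖⁻¹ • w, ‖w‖, norm_smul_inv_norm hw0, ?_, ?_, hn⟩
    · rw [inner_smul_right, hzw, mul_zero]
    · rw [smul_smul, mul_inv_cancel₀ (norm_ne_zero_iff.2 hw0), one_smul, ← hx]

/-! ### Convolution of zonal polynomials and the reproducing formula -/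

-- Write x = t z + s v with v ⊥ z and expand (t z·u + s v·u)^n. The moments of (z·u, v·u) are the
-- same for every orthonormal pair, those odd in v·u vanish, and the even powers of s are powers of
-- s² = 1 - t². What remains is a polynomial in t of degree at most n.
open Polynomial in
theorem exists_convolution_pow {m : ℕ} (hm : 1 ≤ m) (n : ℕ) (q : ℝ[X]) :
    ∃ h : ℝ[X], h.natDegree ≤ n ∧ ∀ x z : USphere m,
      ∫ u, (sphereInner x u : ℝ) ^ n * q.eval (sphereInner u z : ℝ) ∂surfaceMeasure m =
        h.eval (sphereInner x z : ℝ) := by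
  have := isFiniteMeasure_surfaceMeasure hm
  have hc : ∀ i : Fin (m + 1), Continuous fun u : USphere m =>
      (u : EuclideanSpace ℝ (Fin (m + 1))) i := fun i => by fun_prop
  set M : ℕ → ℝ := fun j => ∫ u : USphere m, (u : EuclideanSpace ℝ (Fin (m + 1))) 0 ^ j *
    (u : EuclideanSpace ℝ (Fin (m + 1))) 1 ^ (n - j) *
      q.eval ((u : EuclideanSpace ℝ (Fin (m + 1))) 0) ∂surfaceMeasure m with hM
  refine ⟨∑ j ∈ Finset.range (n + 1), if Even (n - j) then
    C (M j * n.choose j) * (X ^ j * (1 - X ^ 2) ^ ((n - j) / 2)) else 0, ?_, ?_⟩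
  · refine natDegree_sum_le_of_forall_le _ _ fun j hj => ?_
    split_ifs with he
    · refine (natDegree_C_mul_le _ _).trans (natDegree_mul_le.trans ?_)
      have h1 : ((1 - X ^ 2 : ℝ[X]) ^ ((n - j) / 2)).natDegree ≤ (n - j) / 2 * 2 := by
        refine natDegree_pow_le.trans (Nat.mul_le_mul_left _ ?_)
        refine (natDegree_sub_le _ _).trans ?_
        simp
      have h2 : (X ^ j : ℝ[X]).natDegree ≤ j := natDegree_X_pow_le j
      have := Finset.mem_range.1 hj
      omega
    · simp
  · intro x z
    obtain ⟨v, s, hv, hzv, hx, hs⟩ := exists_orthogonal_decomposition hm x z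
    set t : ℝ := (sphereInner x z : ℝ)
    have h1 : ∀ u : USphere m, (sphereInner x u : ℝ) ^ n * q.eval (sphereInner u z : ℝ) =
        (fun a b => (t * a + s * b) ^ n * q.eval a)
          (inner ℝ (z : EuclideanSpace ℝ (Fin (m + 1))) (u : EuclideanSpace ℝ (Fin (m + 1))))
          (inner ℝ v (u : EuclideanSpace ℝ (Fin (m + 1)))) := by
      intro u
      have e1 : (sphereInner x u : ℝ) =
          t * inner ℝ (z : EuclideanSpace ℝ (Fin (m + 1))) (u : EuclideanSpace ℝ (Fin (m + 1))) +
            s * inner ℝ v (u : EuclideanSpace ℝ (Fin (m + 1))) := by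
        simp only [sphereInner]
        rw [hx, inner_add_left, inner_smul_left, inner_smul_left]
        rfl
      have e2 : (sphereInner u z : ℝ) =
          inner ℝ (z : EuclideanSpace ℝ (Fin (m + 1))) (u : EuclideanSpace ℝ (Fin (m + 1))) :=
        real_inner_comm _ _
      simp only [e1, e2]
    simp only [h1]
    rw [integral_pair_surfaceMeasure hm (norm_eq_of_mem_sphere z) hv hzv
      fun a b => (t * a + s * b) ^ n * q.eval a]
    simp only [add_pow, Finset.sum_mul]
    rw [integral_finsetSum _ fun j _ => integrable_of_continuous_compact (by
      have := hc 0; have := hc 1; fun_prop), eval_finsetSum]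
    refine Finset.sum_congr rfl fun j hj => ?_
    have h2 : ∀ a b : ℝ, (t * a) ^ j * (s * b) ^ (n - j) * (n.choose j : ℝ) * q.eval a =
        (t ^ j * s ^ (n - j) * n.choose j) * (a ^ j * b ^ (n - j) * q.eval a) := by
      intro a b; rw [mul_pow, mul_pow]; ring
    simp only [h2]
    rw [integral_const_mul]
    split_ifs with he
    · obtain ⟨r, hr⟩ := he
      have hr2 : (n - j) / 2 = r := by omega
      simp only [eval_mul, eval_C, eval_pow, eval_X, eval_sub, eval_one]
      rw [hr2, ← hs, ← pow_mul, show 2 * r = n - j by omega]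
      ring
    · have h3 := integral_coord_neg_surfaceMeasure hm fun a b => a ^ j * b ^ (n - j) * q.eval a
      simp only [(Nat.not_even_iff_odd.1 he).neg_pow, mul_neg, neg_mul, integral_neg] at h3
      rw [show ∫ u : USphere m, (u : EuclideanSpace ℝ (Fin (m + 1))) 0 ^ j *
        (u : EuclideanSpace ℝ (Fin (m + 1))) 1 ^ (n - j) *
          q.eval ((u : EuclideanSpace ℝ (Fin (m + 1))) 0) ∂surfaceMeasure m = 0 by linarith]
      simp

open Polynomial in
/-- The convolution of two zonal polynomials is zonal, of degree at most that of the first. -/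
theorem exists_convolution {m : ℕ} (hm : 1 ≤ m) (p q : ℝ[X]) :
    ∃ h : ℝ[X], h.natDegree ≤ p.natDegree ∧ ∀ x z : USphere m,
      ∫ u, p.eval (sphereInner x u : ℝ) * q.eval (sphereInner u z : ℝ) ∂surfaceMeasure m =
        h.eval (sphereInner x z : ℝ) := by
  have := isFiniteMeasure_surfaceMeasure hm
  choose h hdeg hh using fun n => exists_convolution_pow hm n q
  refine ⟨∑ n ∈ Finset.range (p.natDegree + 1), C (p.coeff n) * h n, ?_, fun x z => ?_⟩
  · refine natDegree_sum_le_of_forall_le _ _ fun n hn => ?_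
    have := hdeg n
    have := Finset.mem_range.1 hn
    exact (natDegree_C_mul_le _ _).trans (by omega)
  · simp only [eval_eq_sum_range (p := p), Finset.sum_mul, eval_finsetSum, eval_mul, eval_C, ← hh]
    rw [integral_finsetSum _ fun j _ => integrable_of_continuous_compact (by fun_prop)]
    refine Finset.sum_congr rfl fun n _ => ?_
    rw [← integral_const_mul]
    simp only [mul_assoc]

open Polynomial in
/-- The reproducing property of the zonal polynomials `P_k`. -/
theorem integral_sphereP_convolution {m : ℕ} (hm : 1 ≤ m) (k : ℕ) (x z : USphere m) :
    ∫ u, (sphereP m k).eval (sphereInner x u : ℝ) * (sphereP m k).eval (sphereInner u z : ℝ)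
        ∂surfaceMeasure m =
      sphereNormSq m k / (sphereP m k).eval 1 * (sphereP m k).eval (sphereInner x z : ℝ) := by
  have := isFiniteMeasure_surfaceMeasure hm
  obtain ⟨h, hdeg, hh⟩ := exists_convolution hm (sphereP m k) (sphereP m k)
  rw [sphereP_natDegree hm] at hdeg
  obtain ⟨c, rfl⟩ := eq_C_mul_sphereP_of_orthogonal hm (k := k) (h := h)
    (lt_of_le_of_lt degree_le_natDegree (by exact_mod_cast Nat.lt_succ_of_le hdeg)) (by
      intro q hq
      rcases eq_or_ne q 0 with rfl | hq0
      · simp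
      obtain ⟨r, hrdeg, hr⟩ := exists_convolution hm q (sphereP m k)
      rw [← integral_sphereInner hm z (g := fun t => h.eval (t : ℝ) * q.eval (t : ℝ))
        (by fun_prop)]
      simp only [← hh, ← integral_mul_const]
      -- After exchanging the integrals, q is convolved with P_k; the result r has degree at most
      -- that of q, hence below k, and is orthogonal to P_k.
      rw [integral_integral_swap (integrable_of_continuous_compact (by fun_prop))]
      have h1 : ∀ u x : USphere m, (sphereP m k).eval (sphereInner x u : ℝ) *
          (sphereP m k).eval (sphereInner u z : ℝ) * q.eval (sphereInner x z : ℝ) =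
          (sphereP m k).eval (sphereInner u z : ℝ) * (q.eval (sphereInner z x : ℝ) *
            (sphereP m k).eval (sphereInner x u : ℝ)) := by
        intro u x
        rw [sphereInner_comm z x]
        ring
      simp only [h1, integral_const_mul, hr]
      simp only [sphereInner_comm z]
      rw [integral_sphereInner hm z (g := fun t => (sphereP m k).eval (t : ℝ) * r.eval (t : ℝ))
        (by fun_prop)]
      refine integral_sphereP_mul_of_degree_lt hm ?_
      refine lt_of_le_of_lt degree_le_natDegree ?_
      rw [degree_eq_natDegree hq0] at hq
      exact lt_of_le_of_lt (by exact_mod_cast hrdeg) hq)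
  have hP := sphereP_eval_one_pos hm k
  -- On the diagonal the convolution is the squared norm of P_k, which determines c.
  have h2 := hh z z
  simp only [sphereInner_self, eval_mul, eval_C] at h2
  have h3 : sphereNormSq m k = c * (sphereP m k).eval 1 := by
    rw [← h2, sphereNormSq_eq, ← integral_sphereInner hm z
      (g := fun t => (sphereP m k).eval (t : ℝ) ^ 2) (by fun_prop)]
    simp only [sphereInner_comm z, sq]
  rw [hh, h3, mul_div_cancel_right₀ _ hP.ne', eval_mul, eval_C]

/-! ### Positive definite kernels: closure properties and double integrals -/

theorem isPosDefKernel_iff_finset {X : Type*} {K : X → X → ℝ} :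
    IsPosDefKernel K ↔
      ∀ (s : Finset X) (c : X → ℝ), 0 ≤ ∑ x ∈ s, ∑ y ∈ s, c x * c y * K x y := by
  constructor
  · intro h s c
    have hs := h s.card (fun i => s.equivFin.symm i)
      (Subtype.val_injective.comp s.equivFin.symm.injective) fun i => c (s.equivFin.symm i)
    have key : ∀ g : X → ℝ, ∑ i, g (s.equivFin.symm i) = ∑ x ∈ s, g x := fun g => by
      rw [s.equivFin.symm.sum_comp (fun x => g x), Finset.sum_coe_sort]
    have h1 : ∀ x : X, ∑ j, c x * c (s.equivFin.symm j) * K x (s.equivFin.symm j) =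
        ∑ y ∈ s, c x * c y * K x y := fun x => key fun y => c x * c y * K x y
    simp only [h1] at hs
    rwa [key fun x => ∑ y ∈ s, c x * c y * K x y] at hs
  · intro h n x hx c
    have hs := h (Finset.univ.map ⟨x, hx⟩) (Function.extend x c 0)
    simpa [hx.extend_apply] using hs

/-- A case of Schur's product theorem: the quadratic form of the product is the integral over u of
the form of K with coefficients c_i φ_u(x_i). -/
theorem IsPosDefKernel.mul_integral {X U : Type*} {K : X → X → ℝ} (hK : IsPosDefKernel K)
    [MeasurableSpace U] {μ : Measure U} {φ : U → X → ℝ}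
    (hφ : ∀ x y, Integrable (fun u => φ u x * φ u y) μ) :
    IsPosDefKernel fun x y => K x y * ∫ u, φ u x * φ u y ∂μ := by
  intro n x hx c
  have h : ∑ i, ∑ j, c i * c j * (K (x i) (x j) * ∫ u, φ u (x i) * φ u (x j) ∂μ) =
      ∫ u, ∑ i, ∑ j, (c i * φ u (x i)) * (c j * φ u (x j)) * K (x i) (x j) ∂μ := by
    have h1 : ∀ u, ∀ i j, (c i * φ u (x i)) * (c j * φ u (x j)) * K (x i) (x j) =
        (c i * c j * K (x i) (x j)) * (φ u (x i) * φ u (x j)) := fun u i j => by ring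
    simp only [h1]
    rw [integral_finsetSum _ fun i _ => integrable_finsetSum _ fun j _ =>
      (hφ (x i) (x j)).const_mul _]
    refine Finset.sum_congr rfl fun i _ => ?_
    rw [integral_finsetSum _ fun j _ => (hφ (x i) (x j)).const_mul _]
    refine Finset.sum_congr rfl fun j _ => ?_
    rw [integral_const_mul]
    ring
  rw [h]
  exact integral_nonneg fun u => hK n x hx fun i => c i * φ u (x i)

theorem IsPosDefKernel.const_mul {X : Type*} {K : X → X → ℝ} (hK : IsPosDefKernel K) {a : ℝ}
    (ha : 0 ≤ a) : IsPosDefKernel fun x y => a * K x y := by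
  intro n x hx c
  have := mul_nonneg ha (hK n x hx c)
  simp only [Finset.mul_sum] at this
  simpa only [mul_left_comm a] using this

theorem IsPosDefKernel.add {X : Type*} {K L : X → X → ℝ} (hK : IsPosDefKernel K)
    (hL : IsPosDefKernel L) : IsPosDefKernel fun x y => K x y + L x y := by
  intro n x hx c
  simpa only [mul_add, Finset.sum_add_distrib] using add_nonneg (hK n x hx c) (hL n x hx c)

theorem isPosDefKernel_one {X : Type*} : IsPosDefKernel fun _ _ : X => (1 : ℝ) := by
  intro n x hx c
  simp only [mul_one, ← Finset.mul_sum, ← Finset.sum_mul]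
  exact mul_self_nonneg _

theorem IsPosDefKernel.hasSum {X ι : Type*} {L : ι → X → X → ℝ} {K : X → X → ℝ}
    (hL : ∀ i, IsPosDefKernel (L i)) (h : ∀ x y, HasSum (fun i => L i x y) (K x y)) :
    IsPosDefKernel K := by
  intro n x hx c
  refine (hasSum_sum fun i _ => hasSum_sum fun j _ =>
    (h (x i) (x j)).mul_left (c i * c j)).nonneg fun k => hL k n x hx c

theorem integral_simpleFunc_comp {X Y : Type*} [MeasurableSpace X] {μ : Measure X}
    [IsFiniteMeasure μ] (φ : SimpleFunc X Y) (g : Y → ℝ) :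
    ∫ x, g (φ x) ∂μ = ∑ a ∈ φ.range, μ.real (φ ⁻¹' {a}) * g a := by
  classical
  have h : ∀ x, g (φ x) = ∑ a ∈ φ.range, (φ ⁻¹' {a}).indicator 1 x * g a := by
    intro x
    rw [Finset.sum_eq_single (φ x)]
    · simp
    · intro b _ hb
      rw [Set.indicator_of_notMem, zero_mul]
      exact fun h => hb h.symm
    · intro h
      exact absurd (φ.mem_range_self x) h
  simp only [h]
  rw [integral_finsetSum]
  · refine Finset.sum_congr rfl fun a _ => ?_
    rw [integral_mul_const, integral_indicator_one (φ.measurableSet_preimage _)]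
  · intro a _
    exact (((integrable_const (1 : ℝ)).indicator (φ.measurableSet_preimage _))).mul_const _

open Filter Topology in
/-- A continuous positive definite kernel on a compact metric space has nonnegative double
integrals. -/
theorem IsPosDefKernel.integral_nonneg {X : Type*} [MetricSpace X] [CompactSpace X] [Nonempty X]
    [MeasurableSpace X] [BorelSpace X] (μ : Measure X) [IsFiniteMeasure μ] {K : X → X → ℝ}
    (hK : IsPosDefKernel K) (hc : Continuous (Function.uncurry K)) :
    0 ≤ ∫ p : X × X, K p.1 p.2 ∂μ.prod μ := by
  obtain ⟨x₀⟩ := ‹Nonempty X›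
  -- Simple functions approximating the identity turn the double integral into quadratic forms of K,
  -- whose coefficients are the measures of the fibres.
  set φ : ℕ → SimpleFunc X X := fun n =>
    SimpleFunc.approxOn id measurable_id Set.univ x₀ trivial n with hφ
  have hlim : ∀ x, Tendsto (fun n => φ n x) atTop (𝓝 x) := fun x =>
    SimpleFunc.tendsto_approxOn measurable_id (Set.mem_univ x₀) (by simp)
  obtain ⟨C, hC⟩ := (isCompact_range hc).isBounded.exists_norm_le
  have hmeas : ∀ n, Measurable fun p : X × X => K (φ n p.1) (φ n p.2) := fun n =>
    hc.measurable.comp (((φ n).measurable.comp measurable_fst).prodMk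
      ((φ n).measurable.comp measurable_snd))
  have hint : ∀ n, Integrable (fun p : X × X => K (φ n p.1) (φ n p.2)) (μ.prod μ) := fun n =>
    Integrable.of_bound (hmeas n).aestronglyMeasurable C
      (Eventually.of_forall fun p => hC _ ⟨(φ n p.1, φ n p.2), rfl⟩)
  have ht : Tendsto (fun n => ∫ p : X × X, K (φ n p.1) (φ n p.2) ∂μ.prod μ) atTop
      (𝓝 (∫ p : X × X, K p.1 p.2 ∂μ.prod μ)) := by
    refine tendsto_integral_of_dominated_convergence (fun _ => C)
      (fun n => (hmeas n).aestronglyMeasurable) (integrable_const C)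
      (fun n => Eventually.of_forall fun p => hC _ ⟨(φ n p.1, φ n p.2), rfl⟩)
      (Eventually.of_forall fun p => ?_)
    exact (hc.tendsto (p.1, p.2)).comp ((hlim p.1).prodMk_nhds (hlim p.2))
  refine ge_of_tendsto' ht fun n => ?_
  rw [integral_prod _ (hint n)]
  have h1 : ∀ x, ∫ y, K x (φ n y) ∂μ =
      ∑ a ∈ (φ n).range, μ.real (φ n ⁻¹' {a}) * K x a := fun x =>
    integral_simpleFunc_comp (φ n) fun y => K x y
  simp only [h1]
  rw [integral_simpleFunc_comp (φ n) fun x =>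
    ∑ a ∈ (φ n).range, μ.real (φ n ⁻¹' {a}) * K x a]
  have := isPosDefKernel_iff_finset.1 hK (φ n).range fun a => μ.real (φ n ⁻¹' {a})
  simpa only [Finset.mul_sum, mul_assoc] using this

/-! ### Isotropic kernels on the product of spheres -/

/-- The kernel on `S^m × S^M` with isotropic part `F`. -/
noncomputable def isotropicKernel {m M : ℕ} (F : Seg × Seg → ℝ)
    (p q : USphere m × USphere M) : ℝ :=
  F (sphereInner p.1 q.1, sphereInner p.2 q.2)

theorem continuous_uncurry_isotropicKernel {m M : ℕ} {F : Seg × Seg → ℝ} (hF : Continuous F) :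
    Continuous (Function.uncurry (isotropicKernel (m := m) (M := M) F)) := by
  unfold isotropicKernel Function.uncurry
  fun_prop

/-- The reproducing formula presents the extra factor as a positive multiple of a Gram integral, so
`IsPosDefKernel.mul_integral` applies. -/
theorem isPosDefKernel_isotropicKernel_mul_fst {m M : ℕ} (hm : 1 ≤ m) {F : Seg × Seg → ℝ}
    (hF : IsPosDefKernel (isotropicKernel (m := m) (M := M) F)) (k : ℕ) :
    IsPosDefKernel (isotropicKernel (m := m) (M := M)
      fun p => F p * (sphereP m k).eval (p.1 : ℝ)) := by
  have := isFiniteMeasure_surfaceMeasure hm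
  have h := (hF.mul_integral (μ := surfaceMeasure m)
    (φ := fun u p => (sphereP m k).eval (sphereInner p.1 u : ℝ))
    fun x y => integrable_of_continuous_compact (by fun_prop)).const_mul
      (div_pos (sphereP_eval_one_pos hm k) (sphereNormSq_pos hm k)).le
  convert h using 3 with p q
  have h2 := integral_sphereP_convolution hm k p.1 q.1
  simp only [sphereInner_comm _ q.1] at h2 ⊢
  simp only [sphereInner_comm q.1 p.1] at h2
  rw [h2, isotropicKernel, isotropicKernel]
  have := (sphereP_eval_one_pos hm k).ne'
  have := (sphereNormSq_pos hm k).ne'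
  field_simp

theorem isPosDefKernel_isotropicKernel_mul_snd {m M : ℕ} (hM : 1 ≤ M) {F : Seg × Seg → ℝ}
    (hF : IsPosDefKernel (isotropicKernel (m := m) (M := M) F)) (l : ℕ) :
    IsPosDefKernel (isotropicKernel (m := m) (M := M)
      fun p => F p * (sphereP M l).eval (p.2 : ℝ)) := by
  have := isFiniteMeasure_surfaceMeasure hM
  have h := (hF.mul_integral (μ := surfaceMeasure M)
    (φ := fun u p => (sphereP M l).eval (sphereInner p.2 u : ℝ))
    fun x y => integrable_of_continuous_compact (by fun_prop)).const_mul
      (div_pos (sphereP_eval_one_pos hM l) (sphereNormSq_pos hM l)).le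
  convert h using 3 with p q
  have h2 := integral_sphereP_convolution hM l p.2 q.2
  simp only [sphereInner_comm _ q.2] at h2 ⊢
  simp only [sphereInner_comm q.2 p.2] at h2
  rw [h2, isotropicKernel, isotropicKernel]
  have := (sphereP_eval_one_pos hM l).ne'
  have := (sphereNormSq_pos hM l).ne'
  field_simp

theorem map_sphereInner_prod {m M : ℕ} (hm : 1 ≤ m) (hM : 1 ≤ M) (q : USphere m × USphere M) :
    ((surfaceMeasure m).prod (surfaceMeasure M)).map
        (fun p => (sphereInner p.1 q.1, sphereInner p.2 q.2)) =
      (gegenbauerMeasure m).prod (gegenbauerMeasure M) := by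
  have := isFiniteMeasure_surfaceMeasure hm
  have := isFiniteMeasure_surfaceMeasure hM
  rw [← map_sphereInner_surfaceMeasure hm q.1, ← map_sphereInner_surfaceMeasure hM q.2,
    Measure.map_prod_map]
  · rfl
  · exact Continuous.measurable (by fun_prop)
  · exact Continuous.measurable (by fun_prop)

theorem surfaceMeasure_univ_ne_zero {m : ℕ} (hm : 1 ≤ m) : surfaceMeasure m Set.univ ≠ 0 := by
  intro h
  obtain ⟨z, hz, -⟩ := exists_unit_orthogonal hm 0
  have h1 := map_sphereInner_surfaceMeasure hm ⟨z, by simpa using hz⟩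
  rw [Measure.measure_univ_eq_zero.1 h, Measure.map_zero] at h1
  have := isOpenPosMeasure_gegenbauerMeasure m
  exact (isOpen_univ.measure_pos (gegenbauerMeasure m) ⟨⟨1, by norm_num⟩, trivial⟩).ne'
    (by simp [← h1])

theorem nonempty_uSphere {m : ℕ} (hm : 1 ≤ m) : Nonempty (USphere m) := by
  obtain ⟨z, hz, -⟩ := exists_unit_orthogonal hm 0
  exact ⟨⟨z, by simpa using hz⟩⟩

/-- The double integral of the kernel is nonnegative, and its inner integral is independent of the
outer point; hence it equals a positive total mass times the integral of F. -/
theorem integral_nonneg_of_isPosDefKernel_isotropicKernel {m M : ℕ} (hm : 1 ≤ m) (hM : 1 ≤ M)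
    {F : Seg × Seg → ℝ} (hc : Continuous F)
    (hF : IsPosDefKernel (isotropicKernel (m := m) (M := M) F)) :
    0 ≤ ∫ p, F p ∂(gegenbauerMeasure m).prod (gegenbauerMeasure M) := by
  have := isFiniteMeasure_surfaceMeasure hm
  have := isFiniteMeasure_surfaceMeasure hM
  have := nonempty_uSphere hm
  have := nonempty_uSphere hM
  set μ := (surfaceMeasure m).prod (surfaceMeasure M) with hμ
  have h := hF.integral_nonneg μ (continuous_uncurry_isotropicKernel hc)
  have hint : Integrable (Function.uncurry (isotropicKernel (m := m) (M := M) F)) (μ.prod μ) :=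
    integrable_of_continuous_compact (continuous_uncurry_isotropicKernel hc)
  rw [integral_prod_symm (fun p => isotropicKernel F p.1 p.2) hint] at h
  have h1 : ∀ q, ∫ p, isotropicKernel F p q ∂μ =
      ∫ p, F p ∂(gegenbauerMeasure m).prod (gegenbauerMeasure M) := by
    intro q
    rw [← map_sphereInner_prod hm hM q, integral_map (Continuous.aemeasurable (by fun_prop))
      hc.aestronglyMeasurable]
    rfl
  simp only [h1, integral_const, smul_eq_mul] at h
  refine nonneg_of_mul_nonneg_right h ?_
  refine ENNReal.toReal_pos ?_ (measure_ne_top _ _)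
  rw [hμ, ← Set.univ_prod_univ, Measure.prod_prod]
  exact mul_ne_zero (surfaceMeasure_univ_ne_zero hm) (surfaceMeasure_univ_ne_zero hM)

theorem fourierCoeffPS_eq (m M : ℕ) (f : ℝ → ℝ → ℝ) (k l : ℕ) :
    fourierCoeffPS m M f k l = 1 / (sphereNormSq m k * sphereNormSq M l) *
      ∫ p : Seg × Seg, f p.1 p.2 * (sphereP m k).eval (p.1 : ℝ) * (sphereP M l).eval (p.2 : ℝ)
        ∂(gegenbauerMeasure m).prod (gegenbauerMeasure M) := by
  have hemb : MeasurableEmbedding (Subtype.val : Seg → ℝ) :=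
    MeasurableEmbedding.subtype_coe measurableSet_Icc
  have hmap : (volume.restrict (Set.Icc (-1 : ℝ) 1)) =
      ((volume : Measure ℝ).comap (Subtype.val : Seg → ℝ)).map Subtype.val :=
    (map_comap_subtype_coe measurableSet_Icc volume).symm
  have : IsFiniteMeasure ((volume : Measure ℝ).comap (Subtype.val : Seg → ℝ)) := by
    refine ⟨?_⟩
    rw [comap_subtype_coe_apply measurableSet_Icc, Set.image_univ, Subtype.range_coe]
    exact measure_Icc_lt_top
  rw [fourierCoeffPS, Measure.volume_eq_prod, ← Measure.prod_restrict, hmap,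
    Measure.map_prod_map _ _ measurable_subtype_coe measurable_subtype_coe,
    (hemb.prodMap hemb).integral_map, gegenbauerMeasure, gegenbauerMeasure,
    prod_withDensity (by fun_prop) (by fun_prop),
    integral_withDensity_eq_integral_toReal_smul (by fun_prop)
      (by simp [ENNReal.mul_lt_top])]
  congr 1
  refine integral_congr_ae (Filter.Eventually.of_forall fun p => ?_)
  simp only [Prod.map]
  rw [ENNReal.toReal_mul, ENNReal.toReal_ofReal (sphereWeight_nonneg m p.1.2),
    ENNReal.toReal_ofReal (sphereWeight_nonneg M p.2.2), smul_eq_mul, mul_comm]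

/-! ### Nonnegativity and summability of the Fourier coefficients -/

/-- The measure with density `w_m(t) w_M(s)` on `[-1,1]²`. -/
noncomputable abbrev squareMeasure (m M : ℕ) : Measure (Seg × Seg) :=
  (gegenbauerMeasure m).prod (gegenbauerMeasure M)

/-- The Fourier coefficients of a function on `[-1,1]²`. -/
noncomputable def squareCoeff (m M : ℕ) (F : Seg × Seg → ℝ) (k l : ℕ) : ℝ :=
  1 / (sphereNormSq m k * sphereNormSq M l) *
    ∫ p, F p * (sphereP m k).eval (p.1 : ℝ) * (sphereP M l).eval (p.2 : ℝ) ∂squareMeasure m M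

/-- A continuous right inverse of `x ↦ x · z`. -/
theorem exists_continuous_section_sphereInner {m : ℕ} (hm : 1 ≤ m) :
    ∃ (z : USphere m) (γ : Seg → USphere m), Continuous γ ∧ ∀ t, sphereInner z (γ t) = t := by
  obtain ⟨z, hz, -⟩ := exists_unit_orthogonal hm 0
  obtain ⟨v, hv, hzv⟩ := exists_unit_orthogonal hm z
  have hn : ∀ t : Seg, ‖(t : ℝ) • z + √(1 - (t : ℝ) ^ 2) • v‖ = 1 := by
    intro t
    have ht : 0 ≤ 1 - (t : ℝ) ^ 2 := by nlinarith [t.2.1, t.2.2]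
    have h : ‖(t : ℝ) • z + √(1 - (t : ℝ) ^ 2) • v‖ ^ 2 = 1 := by
      rw [norm_add_sq_real, inner_smul_left, inner_smul_right, hzv, norm_smul, norm_smul, hz, hv,
        mul_one, mul_one, Real.norm_eq_abs, Real.norm_eq_abs, sq_abs, sq_abs, Real.sq_sqrt ht]
      ring
    exact (pow_eq_one_iff_of_nonneg (norm_nonneg _) two_ne_zero).1 h
  refine ⟨⟨z, by simpa using hz⟩, fun t => ⟨(t : ℝ) • z + √(1 - (t : ℝ) ^ 2) • v, by
    simpa using hn t⟩, by fun_prop, fun t => Subtype.ext ?_⟩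
  simp only [sphereInner]
  rw [inner_add_right, inner_smul_right, inner_smul_right, hzv, real_inner_self_eq_norm_sq, hz]
  ring

/-- Realize t as an inner product and bound the product in the reproducing formula by half the sum
of squares; each square integrates to τ_k. -/
theorem abs_sphereP_eval_le {m : ℕ} (hm : 1 ≤ m) (k : ℕ) (t : Seg) :
    |(sphereP m k).eval (t : ℝ)| ≤ (sphereP m k).eval 1 := by
  have := isFiniteMeasure_surfaceMeasure hm
  obtain ⟨z, γ, -, hγ⟩ := exists_continuous_section_sphereInner hm
  have h := integral_sphereP_convolution hm k z (γ t)
  rw [hγ] at h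
  have hP := sphereP_eval_one_pos hm k
  have hτ := sphereNormSq_pos hm k
  have hsq : ∀ y : USphere m, ∫ u, (sphereP m k).eval (sphereInner u y : ℝ) ^ 2
      ∂surfaceMeasure m = sphereNormSq m k := fun y => by
    rw [integral_sphereInner hm y (g := fun t => (sphereP m k).eval (t : ℝ) ^ 2) (by fun_prop),
      sphereNormSq_eq]
  have hle : |sphereNormSq m k / (sphereP m k).eval 1 * (sphereP m k).eval (t : ℝ)| ≤
      sphereNormSq m k := by
    rw [← h]
    calc _ ≤ ∫ u, |(sphereP m k).eval (sphereInner z u : ℝ) *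
          (sphereP m k).eval (sphereInner u (γ t) : ℝ)| ∂surfaceMeasure m :=
        abs_integral_le_integral_abs
      _ ≤ ∫ u, (1 / 2 * (sphereP m k).eval (sphereInner u z : ℝ) ^ 2 +
          1 / 2 * (sphereP m k).eval (sphereInner u (γ t) : ℝ) ^ 2) ∂surfaceMeasure m := by
        refine integral_mono (integrable_of_continuous_compact (by fun_prop))
          (integrable_of_continuous_compact (by fun_prop)) fun u => ?_
        simp only [sphereInner_comm z u]
        rw [abs_le]
        constructor <;>
          nlinarith [sq_nonneg ((sphereP m k).eval (sphereInner u z : ℝ) +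
            (sphereP m k).eval (sphereInner u (γ t) : ℝ)),
            sq_nonneg ((sphereP m k).eval (sphereInner u z : ℝ) -
            (sphereP m k).eval (sphereInner u (γ t) : ℝ))]
      _ = sphereNormSq m k := by
        rw [integral_add (integrable_of_continuous_compact (by fun_prop))
          (integrable_of_continuous_compact (by fun_prop)), integral_const_mul,
          integral_const_mul, hsq, hsq]
        ring
  rw [abs_mul, abs_of_pos (div_pos hτ hP), div_mul_eq_mul_div, div_le_iff₀ hP] at hle
  exact le_of_mul_le_mul_left hle hτ

theorem exists_X_eq_C_mul_sphereP_one {m : ℕ} (hm : 1 ≤ m) :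
    ∃ c : ℝ, 0 ≤ c ∧ ∀ t : ℝ, t = c * (sphereP m 1).eval t := by
  unfold sphereP
  split_ifs with h
  · exact ⟨1, zero_le_one, by simp⟩
  · have ha := sphereP_parameter_pos hm h
    refine ⟨(2 * (((m : ℝ) - 1) / 2))⁻¹, by positivity, fun t => ?_⟩
    simp only [gegenbauer, Polynomial.eval_mul, Polynomial.eval_C, Polynomial.eval_X]
    rw [← mul_assoc, inv_mul_cancel₀ (by positivity), one_mul]

/-- The function `((1+t)/2) ((1+s)/2)` on `[-1,1]²`. -/
noncomputable def cornerPeak (p : Seg × Seg) : ℝ := (1 + (p.1 : ℝ)) / 2 * ((1 + (p.2 : ℝ)) / 2)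

@[fun_prop]
theorem continuous_cornerPeak : Continuous cornerPeak := by
  unfold cornerPeak
  fun_prop

theorem cornerPeak_nonneg (p : Seg × Seg) : 0 ≤ cornerPeak p := by
  have := p.1.2.1
  have := p.2.2.1
  unfold cornerPeak
  exact mul_nonneg (by linarith) (by linarith)

/-- Since t is a nonnegative multiple of P_1, multiplication by (1+t)/2 preserves positive
definiteness, and likewise for s. -/
theorem isPosDefKernel_cornerPeak_pow {m M : ℕ} (hm : 1 ≤ m) (hM : 1 ≤ M) (n : ℕ) :
    IsPosDefKernel (isotropicKernel (m := m) (M := M) fun p => cornerPeak p ^ n) := by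
  obtain ⟨a, ha, hat⟩ := exists_X_eq_C_mul_sphereP_one hm
  obtain ⟨b, hb, hbs⟩ := exists_X_eq_C_mul_sphereP_one hM
  induction n with
  | zero =>
    simp only [pow_zero]
    exact isPosDefKernel_one
  | succ n ih =>
    have h1 := (ih.add ((isPosDefKernel_isotropicKernel_mul_fst hm ih 1).const_mul ha)).const_mul
      (a := 1 / 2) (by norm_num)
    have h1' : IsPosDefKernel (isotropicKernel (m := m) (M := M)
        fun p => cornerPeak p ^ n * ((1 + (p.1 : ℝ)) / 2)) := by
      convert h1 using 3 with p q
      simp only [isotropicKernel]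
      linear_combination cornerPeak (sphereInner p.1 q.1, sphereInner p.2 q.2) ^ n / 2 *
        hat (sphereInner p.1 q.1 : ℝ)
    have h2 := (h1'.add ((isPosDefKernel_isotropicKernel_mul_snd hM h1' 1).const_mul hb)).const_mul
      (a := 1 / 2) (by norm_num)
    convert h2 using 3 with p q
    simp only [isotropicKernel, pow_succ]
    nth_rewrite 2 [cornerPeak]
    linear_combination cornerPeak (sphereInner p.1 q.1, sphereInner p.2 q.2) ^ n *
      ((1 + (sphereInner p.1 q.1 : ℝ)) / 4) * hbs (sphereInner p.2 q.2 : ℝ)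

theorem integral_mul_sphereP_nonneg {m M : ℕ} (hm : 1 ≤ m) (hM : 1 ≤ M) {F : Seg × Seg → ℝ}
    (hc : Continuous F) (hF : IsPosDefKernel (isotropicKernel (m := m) (M := M) F)) (k l : ℕ) :
    0 ≤ ∫ p, F p * (sphereP m k).eval (p.1 : ℝ) * (sphereP M l).eval (p.2 : ℝ)
      ∂squareMeasure m M :=
  integral_nonneg_of_isPosDefKernel_isotropicKernel hm hM (by fun_prop)
    (isPosDefKernel_isotropicKernel_mul_snd hM
      (isPosDefKernel_isotropicKernel_mul_fst hm hF k) l)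

theorem squareCoeff_nonneg {m M : ℕ} (hm : 1 ≤ m) (hM : 1 ≤ M) {F : Seg × Seg → ℝ}
    (hc : Continuous F) (hF : IsPosDefKernel (isotropicKernel (m := m) (M := M) F)) (k l : ℕ) :
    0 ≤ squareCoeff m M F k l :=
  mul_nonneg (one_div_nonneg.2
    (mul_pos (sphereNormSq_pos hm k) (sphereNormSq_pos hM l)).le)
    (integral_mul_sphereP_nonneg hm hM hc hF k l)

theorem integral_eq_squareCoeff {m M : ℕ} (hm : 1 ≤ m) (hM : 1 ≤ M) (F : Seg × Seg → ℝ)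
    (k l : ℕ) :
    ∫ p, F p * (sphereP m k).eval (p.1 : ℝ) * (sphereP M l).eval (p.2 : ℝ) ∂squareMeasure m M =
      sphereNormSq m k * sphereNormSq M l * squareCoeff m M F k l := by
  have := (sphereNormSq_pos hm k).ne'
  have := (sphereNormSq_pos hM l).ne'
  rw [squareCoeff]
  field_simp

open Polynomial in
theorem integral_sum_sphereP_mul {m : ℕ} (hm : 1 ≤ m) {n k : ℕ} (hk : k < n) (b : ℕ → ℝ) :
    ∫ t : Seg, (∑ i ∈ Finset.range n, C (b i) * sphereP m i).eval (t : ℝ) *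
      (sphereP m k).eval (t : ℝ) ∂gegenbauerMeasure m = b k * sphereNormSq m k := by
  have := isFiniteMeasure_gegenbauerMeasure hm
  simp only [eval_finsetSum, eval_mul, eval_C, Finset.sum_mul, mul_assoc]
  rw [integral_finsetSum _ fun i _ => integrable_of_continuous_compact (by fun_prop),
    Finset.sum_eq_single k]
  · rw [integral_const_mul, sphereNormSq_eq]
    simp only [sq]
  · intro i _ hi
    rw [integral_const_mul, integral_sphereP_mul_sphereP hm hi, mul_zero]
  · intro h
    exact absurd (Finset.mem_range.2 hk) h

open Polynomial in
theorem exists_expansion_half_one_add_pow {m : ℕ} (hm : 1 ≤ m) (n : ℕ) :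
    ∃ b : ℕ → ℝ, ∀ t : ℝ, ((1 + t) / 2) ^ n =
      (∑ i ∈ Finset.range (n + 1), C (b i) * sphereP m i).eval t := by
  have hd : ((C (1 / 2) * (1 + X) : ℝ[X]) ^ n).degree < (n + 1 : ℕ) := by
    refine lt_of_le_of_lt degree_le_natDegree ?_
    have h1 : (C (1 / 2) * (1 + X) : ℝ[X]).natDegree ≤ 1 :=
      (natDegree_C_mul_le _ _).trans ((natDegree_add_le _ _).trans (by simp))
    have h2 := natDegree_pow_le_of_le n h1
    rw [mul_one] at h2
    exact_mod_cast Nat.lt_succ_of_le h2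
  obtain ⟨b, hb⟩ := exists_eq_sum_sphereP hm (n + 1) _ hd
  refine ⟨b, fun t => ?_⟩
  rw [← hb]
  simp only [eval_pow, eval_mul, eval_C, eval_add, eval_one, eval_X]
  ring

-- Parseval's identity without convergence questions: the test function is a polynomial of degree n
-- in each variable.
open Polynomial in
theorem integral_cornerPeak_pow_mul {m M : ℕ} (hm : 1 ≤ m) (hM : 1 ≤ M) {F : Seg × Seg → ℝ}
    (hc : Continuous F) (n : ℕ) :
    ∫ p, cornerPeak p ^ n * F p ∂squareMeasure m M =
      ∑ q ∈ Finset.range (n + 1) ×ˢ Finset.range (n + 1),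
        (∫ p, cornerPeak p ^ n * (sphereP m q.1).eval (p.1 : ℝ) * (sphereP M q.2).eval (p.2 : ℝ)
          ∂squareMeasure m M) * squareCoeff m M F q.1 q.2 := by
  have := isFiniteMeasure_gegenbauerMeasure hm
  have := isFiniteMeasure_gegenbauerMeasure hM
  obtain ⟨b, hb⟩ := exists_expansion_half_one_add_pow hm n
  obtain ⟨d, hd⟩ := exists_expansion_half_one_add_pow hM n
  have h1 : ∀ p : Seg × Seg, cornerPeak p ^ n * F p =
      ∑ q ∈ Finset.range (n + 1) ×ˢ Finset.range (n + 1), b q.1 * d q.2 *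
        (F p * (sphereP m q.1).eval (p.1 : ℝ) * (sphereP M q.2).eval (p.2 : ℝ)) := by
    intro p
    rw [cornerPeak, mul_pow, hb, hd, eval_finsetSum, eval_finsetSum, Finset.sum_mul_sum,
      Finset.sum_product, Finset.sum_mul]
    refine Finset.sum_congr rfl fun i _ => ?_
    rw [Finset.sum_mul]
    refine Finset.sum_congr rfl fun j _ => ?_
    simp only [eval_mul, eval_C]
    ring
  simp only [h1]
  rw [integral_finsetSum _ fun i _ => integrable_of_continuous_compact (by fun_prop)]
  refine Finset.sum_congr rfl fun q hq => ?_
  obtain ⟨hq1, hq2⟩ := Finset.mem_product.1 hq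
  rw [integral_const_mul, integral_eq_squareCoeff hm hM]
  set G : Seg → ℝ := fun t => (∑ i ∈ Finset.range (n + 1), C (b i) * sphereP m i).eval (t : ℝ) *
    (sphereP m q.1).eval (t : ℝ) with hG
  set H : Seg → ℝ := fun t => (∑ i ∈ Finset.range (n + 1), C (d i) * sphereP M i).eval (t : ℝ) *
    (sphereP M q.2).eval (t : ℝ) with hH
  have h2 : ∀ p : Seg × Seg, cornerPeak p ^ n * (sphereP m q.1).eval (p.1 : ℝ) *
      (sphereP M q.2).eval (p.2 : ℝ) =
      G p.1 * H p.2 := by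
    intro p
    simp only [hG, hH]
    rw [cornerPeak, mul_pow, hb, hd]
    ring
  simp only [h2]
  rw [integral_prod_mul, hG, hH, integral_sum_sphereP_mul hm (Finset.mem_range.1 hq1),
    integral_sum_sphereP_mul hM (Finset.mem_range.1 hq2)]
  ring

-- The peak function attains its maximum 1 only at (1,1), so its normalized powers form an
-- approximate identity there.
open Filter Topology in
theorem tendsto_cornerPeak {m M : ℕ} (hm : 1 ≤ m) (hM : 1 ≤ M) {g : Seg × Seg → ℝ}
    (hg : Continuous g) :
    Tendsto (fun n : ℕ => (∫ p, cornerPeak p ^ n ∂squareMeasure m M)⁻¹ *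
      ∫ p, cornerPeak p ^ n * g p ∂squareMeasure m M) atTop
      (𝓝 (g (⟨1, by norm_num⟩, ⟨1, by norm_num⟩))) := by
  have := isFiniteMeasure_gegenbauerMeasure hm
  have := isFiniteMeasure_gegenbauerMeasure hM
  have := isOpenPosMeasure_gegenbauerMeasure m
  have := isOpenPosMeasure_gegenbauerMeasure M
  have h := tendsto_setIntegral_pow_smul_of_unique_maximum_of_isCompact_of_continuousOn
    (μ := squareMeasure m M) (s := Set.univ) (c := cornerPeak) (g := g)
    (x₀ := ((⟨1, by norm_num⟩, ⟨1, by norm_num⟩) : Seg × Seg)) isCompact_univ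
    continuous_cornerPeak.continuousOn ?_ (fun p _ => cornerPeak_nonneg p) ?_ (by simp)
    hg.continuousOn
  · simpa using h
  · rintro ⟨⟨t, ht⟩, ⟨s, hs⟩⟩ - hne
    simp only [cornerPeak]
    by_contra hcon
    refine hne ?_
    have h1 : t = 1 := by nlinarith [ht.1, ht.2, hs.1, hs.2]
    have h2 : s = 1 := by nlinarith [ht.1, ht.2, hs.1, hs.2]
    subst h1 h2
    rfl
  · simp [cornerPeak]

-- In the finite Parseval sum all terms are nonnegative, so those outside s may be dropped once n is
-- large. Dividing by the mass of the peak and letting n grow turns the remaining factors into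
-- P_k(1) P_l(1).
open Filter Topology in
theorem sum_squareCoeff_le {m M : ℕ} (hm : 1 ≤ m) (hM : 1 ≤ M) {F : Seg × Seg → ℝ}
    (hc : Continuous F) (hF : IsPosDefKernel (isotropicKernel (m := m) (M := M) F)) {B : ℝ}
    (hB : ∀ p, F p ≤ B) (hB0 : 0 ≤ B) (s : Finset (ℕ × ℕ)) :
    ∑ q ∈ s, squareCoeff m M F q.1 q.2 * (sphereP m q.1).eval 1 * (sphereP M q.2).eval 1 ≤ B := by
  have := isFiniteMeasure_gegenbauerMeasure hm
  have := isFiniteMeasure_gegenbauerMeasure hM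
  have hI : ∀ n, 0 ≤ ∫ p, cornerPeak p ^ n ∂squareMeasure m M := fun n =>
    integral_nonneg fun p => pow_nonneg (cornerPeak_nonneg p) n
  have hlim : Tendsto (fun n : ℕ => ∑ q ∈ s, (∫ p, cornerPeak p ^ n ∂squareMeasure m M)⁻¹ *
      (∫ p, cornerPeak p ^ n * ((sphereP m q.1).eval (p.1 : ℝ) * (sphereP M q.2).eval (p.2 : ℝ))
          ∂squareMeasure m M) * squareCoeff m M F q.1 q.2) atTop
      (𝓝 (∑ q ∈ s, (sphereP m q.1).eval 1 * (sphereP M q.2).eval 1 *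
        squareCoeff m M F q.1 q.2)) := by
    refine tendsto_finsetSum _ fun q _ => (tendsto_cornerPeak hm hM (g := fun p =>
      (sphereP m q.1).eval (p.1 : ℝ) * (sphereP M q.2).eval (p.2 : ℝ)) (by fun_prop)).mul_const _
  have heq : ∀ q : ℕ × ℕ, squareCoeff m M F q.1 q.2 * (sphereP m q.1).eval 1 *
      (sphereP M q.2).eval 1 =
      (sphereP m q.1).eval 1 * (sphereP M q.2).eval 1 * squareCoeff m M F q.1 q.2 := fun q => by
    ring
  simp only [heq]
  obtain ⟨N, hN⟩ : ∃ N, ∀ q ∈ s, q.1 ≤ N ∧ q.2 ≤ N := by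
    refine ⟨s.sup fun q => q.1 + q.2, fun q hq => ?_⟩
    have : q.1 + q.2 ≤ s.sup fun q => q.1 + q.2 :=
      Finset.le_sup (f := fun q : ℕ × ℕ => q.1 + q.2) hq
    omega
  refine le_of_tendsto hlim (eventually_atTop.2 ⟨N, fun n hn => ?_⟩)
  have hle : ∫ p, cornerPeak p ^ n * F p ∂squareMeasure m M ≤
      B * ∫ p, cornerPeak p ^ n ∂squareMeasure m M := by
    rw [← integral_const_mul]
    refine integral_mono (integrable_of_continuous_compact (by fun_prop))
      (integrable_of_continuous_compact (by fun_prop)) fun p => ?_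
    simp only
    rw [mul_comm B]
    exact mul_le_mul_of_nonneg_left (hB p) (pow_nonneg (cornerPeak_nonneg p) n)
  rw [integral_cornerPeak_pow_mul hm hM hc n] at hle
  have hsub : ∑ q ∈ s, (∫ p, cornerPeak p ^ n * (sphereP m q.1).eval (p.1 : ℝ) *
      (sphereP M q.2).eval (p.2 : ℝ) ∂squareMeasure m M) * squareCoeff m M F q.1 q.2 ≤
      B * ∫ p, cornerPeak p ^ n ∂squareMeasure m M := by
    refine le_trans (Finset.sum_le_sum_of_subset_of_nonneg ?_ fun q _ _ => ?_) hle
    · intro q hq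
      have := hN q hq
      simp only [Finset.mem_product, Finset.mem_range]
      omega
    · exact mul_nonneg (integral_mul_sphereP_nonneg hm hM (by fun_prop)
        (isPosDefKernel_cornerPeak_pow hm hM n) _ _) (squareCoeff_nonneg hm hM hc hF _ _)
  simp only [mul_assoc] at hsub ⊢
  rw [← Finset.mul_sum]
  calc _ ≤ (∫ p, cornerPeak p ^ n ∂squareMeasure m M)⁻¹ *
        (B * ∫ p, cornerPeak p ^ n ∂squareMeasure m M) :=
        mul_le_mul_of_nonneg_left hsub (inv_nonneg.2 (hI n))
    _ = B * ((∫ p, cornerPeak p ^ n ∂squareMeasure m M)⁻¹ *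
        ∫ p, cornerPeak p ^ n ∂squareMeasure m M) := by ring
    -- The bound a⁻¹ * a ≤ 1 also holds for a = 0, so the mass need not be shown positive.
    _ ≤ B := mul_le_of_le_one_right hB0 inv_mul_le_one

/-! ### Completeness of the tensor family and convergence of the expansion -/

/-- Integration against a continuous function, as a functional on `C([-1,1]²)`. -/
noncomputable def integralMulCLM {X : Type*} [TopologicalSpace X] [CompactSpace X]
    [MeasurableSpace X] [OpensMeasurableSpace X] (μ : Measure X) [IsFiniteMeasure μ]
    (φ : C(X, ℝ)) : C(X, ℝ) →L[ℝ] ℝ :=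
  LinearMap.mkContinuous
    { toFun := fun G => ∫ p, G p * φ p ∂μ
      map_add' := fun G H => by
        simp only [ContinuousMap.add_apply, add_mul]
        exact integral_add (integrable_of_continuous_compact (by fun_prop))
          (integrable_of_continuous_compact (by fun_prop))
      map_smul' := fun a G => by
        simp only [ContinuousMap.smul_apply, smul_eq_mul, mul_assoc, integral_const_mul,
          RingHom.id_apply] }
    (∫ p, |φ p| ∂μ) fun G => by
      change ‖∫ p, G p * φ p ∂μ‖ ≤ _
      refine (norm_integral_le_integral_norm _).trans ?_
      rw [← integral_mul_const]
      refine integral_mono (integrable_of_continuous_compact (by fun_prop))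
        (integrable_of_continuous_compact (by fun_prop)) fun p => ?_
      simp only
      rw [norm_mul, mul_comm, Real.norm_eq_abs (φ p)]
      exact mul_le_mul_of_nonneg_left (G.norm_coe_le_norm p) (abs_nonneg _)

theorem integralMulCLM_apply {X : Type*} [TopologicalSpace X] [CompactSpace X]
    [MeasurableSpace X] [OpensMeasurableSpace X] (μ : Measure X) [IsFiniteMeasure μ]
    (φ G : C(X, ℝ)) : integralMulCLM μ φ G = ∫ p, G p * φ p ∂μ := rfl

/-- The first coordinate as an element of `C([-1,1]²)`. -/
def segFst : C(Seg × Seg, ℝ) := ⟨fun p => (p.1 : ℝ), by fun_prop⟩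

/-- The second coordinate as an element of `C([-1,1]²)`. -/
def segSnd : C(Seg × Seg, ℝ) := ⟨fun p => (p.2 : ℝ), by fun_prop⟩

theorem adjoin_coordinates_dense :
    (Algebra.adjoin ℝ {segFst, segSnd}).topologicalClosure = ⊤ := by
  refine ContinuousMap.subalgebra_topologicalClosure_eq_top_of_separatesPoints _ ?_
  rintro ⟨t, s⟩ ⟨t', s'⟩ hne
  by_cases ht : t = t'
  · have hs : s ≠ s' := fun h => hne (by rw [ht, h])
    exact ⟨segSnd, ⟨segSnd, Algebra.subset_adjoin (by simp), rfl⟩, fun h => hs (Subtype.ext h)⟩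
  · exact ⟨segFst, ⟨segFst, Algebra.subset_adjoin (by simp), rfl⟩, fun h => ht (Subtype.ext h)⟩

open Polynomial in
/-- A continuous function on `[-1,1]²` orthogonal to all `P_k(t) P_l(s)` vanishes. -/
theorem eq_zero_of_orthogonal_sphereP {m M : ℕ} (hm : 1 ≤ m) (hM : 1 ≤ M) (D : C(Seg × Seg, ℝ))
    (hD : ∀ k l, ∫ p, D p * (sphereP m k).eval (p.1 : ℝ) * (sphereP M l).eval (p.2 : ℝ)
      ∂squareMeasure m M = 0) : D = 0 := by
  have := isFiniteMeasure_gegenbauerMeasure hm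
  have := isFiniteMeasure_gegenbauerMeasure hM
  have := isOpenPosMeasure_gegenbauerMeasure m
  have := isOpenPosMeasure_gegenbauerMeasure M
  -- This continuous functional vanishes on monomials, hence on their dense span, hence at D itself,
  -- which makes the integral of D² zero.
  set Λ := integralMulCLM (squareMeasure m M) D with hΛ
  have hmono : ∀ i j : ℕ, Λ (segFst ^ i * segSnd ^ j) = 0 := by
    intro i j
    obtain ⟨b, hb⟩ := exists_eq_sum_sphereP hm (i + 1) (X ^ i)
      (by rw [degree_X_pow]; exact_mod_cast Nat.lt_succ_self i)
    obtain ⟨d, hd⟩ := exists_eq_sum_sphereP hM (j + 1) (X ^ j)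
      (by rw [degree_X_pow]; exact_mod_cast Nat.lt_succ_self j)
    have hb' : ∀ t : ℝ, t ^ i =
        (∑ k ∈ Finset.range (i + 1), C (b k) * sphereP m k).eval t := fun t => by
      rw [← hb, eval_pow, eval_X]
    have hd' : ∀ t : ℝ, t ^ j =
        (∑ k ∈ Finset.range (j + 1), C (d k) * sphereP M k).eval t := fun t => by
      rw [← hd, eval_pow, eval_X]
    have h1 : ∀ p : Seg × Seg, (segFst ^ i * segSnd ^ j) p * D p =
        ∑ k ∈ Finset.range (i + 1), ∑ l ∈ Finset.range (j + 1), b k * d l *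
          (D p * (sphereP m k).eval (p.1 : ℝ) * (sphereP M l).eval (p.2 : ℝ)) := by
      intro p
      change (p.1 : ℝ) ^ i * (p.2 : ℝ) ^ j * D p = _
      rw [hb', hd', eval_finsetSum, eval_finsetSum, Finset.sum_mul_sum, Finset.sum_mul]
      refine Finset.sum_congr rfl fun k _ => ?_
      rw [Finset.sum_mul]
      refine Finset.sum_congr rfl fun l _ => ?_
      simp only [eval_mul, eval_C]
      ring
    rw [hΛ, integralMulCLM_apply]
    simp only [h1]
    rw [integral_finsetSum _ fun k _ => integrable_of_continuous_compact (by fun_prop)]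
    refine Finset.sum_eq_zero fun k _ => ?_
    rw [integral_finsetSum _ fun k _ => integrable_of_continuous_compact (by fun_prop)]
    refine Finset.sum_eq_zero fun l _ => ?_
    rw [integral_const_mul, hD, mul_zero]
  have hadj : ∀ G ∈ Algebra.adjoin ℝ {segFst, segSnd}, Λ G = 0 := by
    intro G hG
    rw [← Subalgebra.mem_toSubmodule, Algebra.adjoin_eq_span] at hG
    induction hG using Submodule.span_induction with
    | mem G hG =>
      obtain ⟨i, j, rfl⟩ := (Submonoid.mem_closure_pair _ _ _).1 hG
      exact hmono i j
    | zero => exact map_zero Λ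
    | add G H _ _ hG hH => rw [map_add, hG, hH, add_zero]
    | smul a G _ hG => rw [map_smul, hG, smul_zero]
  have hall : Λ D = 0 := by
    have hmem : D ∈ closure (Algebra.adjoin ℝ {segFst, segSnd} : Set C(Seg × Seg, ℝ)) := by
      rw [← Subalgebra.topologicalClosure_coe, adjoin_coordinates_dense]
      trivial
    exact (closure_minimal (t := {G | Λ G = 0}) hadj
      (isClosed_singleton.preimage Λ.continuous)) hmem
  rw [hΛ, integralMulCLM_apply] at hall
  have hc : Continuous fun p => D p * D p := by fun_prop
  rw [integral_eq_zero_iff_of_nonneg (fun p => mul_self_nonneg _)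
    (integrable_of_continuous_compact hc), hc.ae_eq_iff_eq _ continuous_zero] at hall
  ext p
  exact mul_self_eq_zero.1 (congrFun hall p)

theorem integral_sphereP_mul_sphereP_prod {m M : ℕ} (hm : 1 ≤ m) (hM : 1 ≤ M) (k l i j : ℕ) :
    ∫ p : Seg × Seg, ((sphereP m k).eval (p.1 : ℝ) * (sphereP M l).eval (p.2 : ℝ)) *
      ((sphereP m i).eval (p.1 : ℝ) * (sphereP M j).eval (p.2 : ℝ)) ∂squareMeasure m M =
      if (k, l) = (i, j) then sphereNormSq m i * sphereNormSq M j else 0 := by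
  have := isFiniteMeasure_gegenbauerMeasure hm
  have := isFiniteMeasure_gegenbauerMeasure hM
  set G : Seg → ℝ := fun t => (sphereP m k).eval (t : ℝ) * (sphereP m i).eval (t : ℝ) with hG
  set H : Seg → ℝ := fun t => (sphereP M l).eval (t : ℝ) * (sphereP M j).eval (t : ℝ) with hH
  have h : ∀ p : Seg × Seg, ((sphereP m k).eval (p.1 : ℝ) * (sphereP M l).eval (p.2 : ℝ)) *
      ((sphereP m i).eval (p.1 : ℝ) * (sphereP M j).eval (p.2 : ℝ)) = G p.1 * H p.2 := fun p => by
    simp only [hG, hH]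
    ring
  simp only [h]
  rw [integral_prod_mul, hG, hH]
  split_ifs with hkl
  · obtain ⟨rfl, rfl⟩ := Prod.mk.inj hkl
    simp only [sphereNormSq_eq, sq]
  · by_cases hk : k = i
    · have hl : l ≠ j := fun hl => hkl (by rw [hk, hl])
      rw [integral_sphereP_mul_sphereP hM hl, mul_zero]
    · rw [integral_sphereP_mul_sphereP hm hk, zero_mul]

/-- The values at (1,1) dominate the sup norms of the terms, so the series converges in C([-1,1]²).
Integrating termwise, its sum S has the coefficients of F, and completeness gives F = S. -/
theorem summable_and_hasSum_squareCoeff {m M : ℕ} (hm : 1 ≤ m) (hM : 1 ≤ M)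
    (F : C(Seg × Seg, ℝ)) (hF : IsPosDefKernel (isotropicKernel (m := m) (M := M) F)) :
    Summable (fun q : ℕ × ℕ => squareCoeff m M F q.1 q.2 * (sphereP m q.1).eval 1 *
        (sphereP M q.2).eval 1) ∧
      ∀ p : Seg × Seg, HasSum (fun q : ℕ × ℕ => squareCoeff m M F q.1 q.2 *
        (sphereP m q.1).eval (p.1 : ℝ) * (sphereP M q.2).eval (p.2 : ℝ)) (F p) := by
  have := isFiniteMeasure_gegenbauerMeasure hm
  have := isFiniteMeasure_gegenbauerMeasure hM
  have hnn := squareCoeff_nonneg hm hM F.continuous hF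
  have hsum : Summable (fun q : ℕ × ℕ => squareCoeff m M F q.1 q.2 * (sphereP m q.1).eval 1 *
      (sphereP M q.2).eval 1) := by
    refine summable_of_sum_le (c := ‖F‖) (fun q => ?_) fun s =>
      sum_squareCoeff_le hm hM F.continuous hF
        (fun p => (le_abs_self _).trans (F.norm_coe_le_norm p)) (norm_nonneg F) s
    exact mul_nonneg (mul_nonneg (hnn _ _) (sphereP_eval_one_pos hm _).le)
      (sphereP_eval_one_pos hM _).le
  refine ⟨hsum, ?_⟩
  set E : ℕ × ℕ → C(Seg × Seg, ℝ) := fun q =>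
    ⟨fun p => (sphereP m q.1).eval (p.1 : ℝ) * (sphereP M q.2).eval (p.2 : ℝ), by fun_prop⟩ with hE
  have hEapp : ∀ q p, E q p = (sphereP m q.1).eval (p.1 : ℝ) * (sphereP M q.2).eval (p.2 : ℝ) :=
    fun _ _ => rfl
  have hnorm : ∀ q : ℕ × ℕ, ‖squareCoeff m M F q.1 q.2 • E q‖ ≤
      squareCoeff m M F q.1 q.2 * (sphereP m q.1).eval 1 * (sphereP M q.2).eval 1 := by
    intro q
    rw [norm_smul, Real.norm_of_nonneg (hnn _ _), mul_assoc]
    refine mul_le_mul_of_nonneg_left ?_ (hnn _ _)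
    refine (ContinuousMap.norm_le _ (mul_nonneg (sphereP_eval_one_pos hm _).le
      (sphereP_eval_one_pos hM _).le)).2 fun p => ?_
    rw [hEapp, norm_mul]
    exact mul_le_mul (abs_sphereP_eval_le hm _ _) (abs_sphereP_eval_le hM _ _) (norm_nonneg _)
      (sphereP_eval_one_pos hm _).le
  have hS : Summable fun q : ℕ × ℕ => squareCoeff m M F q.1 q.2 • E q :=
    Summable.of_norm_bounded hsum hnorm
  obtain ⟨S, hS⟩ := hS
  have hFS : F - S = 0 := by
    refine eq_zero_of_orthogonal_sphereP hm hM _ fun i j => ?_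
    have h1 := hS.mapL (integralMulCLM (squareMeasure m M) (E (i, j)))
    simp only [map_smul, integralMulCLM_apply, hEapp,
      integral_sphereP_mul_sphereP_prod hm hM] at h1
    have h2 := h1.unique (hasSum_single (i, j) fun q hq => by
      rw [if_neg hq, smul_zero])
    rw [if_pos rfl, smul_eq_mul] at h2
    have h3 := integral_eq_squareCoeff hm hM F i j
    simp only [mul_assoc] at h2 h3 ⊢
    simp only [ContinuousMap.sub_apply, sub_mul]
    rw [integral_sub (integrable_of_continuous_compact (by fun_prop))
      (integrable_of_continuous_compact (by fun_prop)), h2, h3]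
    ring
  intro p
  rw [sub_eq_zero.1 hFS]
  have h := hS.mapL (ContinuousMap.evalCLM ℝ p)
  simpa only [map_smul, ContinuousMap.evalCLM_apply, hEapp, smul_eq_mul, ← mul_assoc,
    ← sub_eq_zero.1 hFS] using h

/-! ### The two directions of the theorem -/

theorem IsPosDefKernel.of_hasSchoenbergExpansion {m M : ℕ} (hm : 1 ≤ m) (hM : 1 ≤ M)
    {K : USphere m × USphere M → USphere m × USphere M → ℝ} {f : ℝ → ℝ → ℝ}
    (hf : IsIsotropicPart f K) {a : ℕ → ℕ → ℝ} (h : HasSchoenbergExpansion m M f a) :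
    IsPosDefKernel K := by
  obtain ⟨ha, -, hs⟩ := h
  refine IsPosDefKernel.hasSum (L := fun q : ℕ × ℕ => isotropicKernel fun p => a q.1 q.2 *
    (sphereP m q.1).eval (p.1 : ℝ) * (sphereP M q.2).eval (p.2 : ℝ)) (fun q => ?_) fun x y => ?_
  · have h1 : IsPosDefKernel (isotropicKernel (m := m) (M := M) fun _ => a q.1 q.2) := by
      simpa only [mul_one] using! (isPosDefKernel_one (X := USphere m × USphere M)).const_mul
        (ha q.1 q.2)
    exact isPosDefKernel_isotropicKernel_mul_snd hM
      (isPosDefKernel_isotropicKernel_mul_fst hm h1 q.1) q.2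
  · rw [show K x y = _ from hf x.1 y.1 x.2 y.2]
    exact hs _ (sphereInner x.1 y.1).2 _ (sphereInner x.2 y.2).2

theorem IsPosDefKernel.hasSchoenbergExpansion {m M : ℕ} (hm : 1 ≤ m) (hM : 1 ≤ M)
    {K : USphere m × USphere M → USphere m × USphere M → ℝ}
    (hK : Continuous (Function.uncurry K)) {f : ℝ → ℝ → ℝ} (hf : IsIsotropicPart f K)
    (h : IsPosDefKernel K) : HasSchoenbergExpansion m M f (fourierCoeffPS m M f) := by
  -- Continuity is assumed of K only; along continuous sections of the inner products it passes to f
  -- on the square.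
  obtain ⟨z, γ, hγc, hγ⟩ := exists_continuous_section_sphereInner hm
  obtain ⟨w, δ, hδc, hδ⟩ := exists_continuous_section_sphereInner hM
  have hfK : ∀ p : Seg × Seg, f p.1 p.2 = Function.uncurry K ((z, w), (γ p.1, δ p.2)) := by
    intro p
    have := hf z (γ p.1) w (δ p.2)
    rw [Function.uncurry_apply_pair, this]
    nth_rewrite 1 [← hγ p.1, ← hδ p.2]
    rfl
  have hc : Continuous fun p : Seg × Seg => f p.1 p.2 := by
    simp only [hfK]
    fun_prop
  have hiso : K = isotropicKernel (fun p : Seg × Seg => f p.1 p.2) := by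
    funext x y
    exact hf x.1 y.1 x.2 y.2
  have hcoeff : ∀ k l, fourierCoeffPS m M f k l =
      squareCoeff m M (fun p => f p.1 p.2) k l := fun k l => fourierCoeffPS_eq m M f k l
  rw [hiso] at h
  obtain ⟨h1, h2⟩ := summable_and_hasSum_squareCoeff hm hM ⟨_, hc⟩ h
  refine ⟨fun k l => ?_, ?_, fun t ht s hs => ?_⟩
  · rw [hcoeff]
    exact squareCoeff_nonneg hm hM hc h k l
  · simp only [hcoeff]
    exact h1
  · simp only [hcoeff]
    exact h2 (⟨t, ht⟩, ⟨s, hs⟩)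

theorem mainTheorem1 (m M : ℕ) (hm : 1 ≤ m) (hM : 1 ≤ M)
    (K : USphere m × USphere M → USphere m × USphere M → ℝ)
    (hK : Continuous (Function.uncurry K))
    (f : ℝ → ℝ → ℝ) (hf : IsIsotropicPart f K) :
    (IsPosDefKernel K ↔ HasSchoenbergExpansion m M f (fourierCoeffPS m M f)) ∧
    (IsPosDefKernel K ↔ ∃ a : ℕ → ℕ → ℝ, HasSchoenbergExpansion m M f a) :=
  ⟨⟨fun h => h.hasSchoenbergExpansion hm hM hK hf, fun h => .of_hasSchoenbergExpansion hm hM hf h⟩,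
    ⟨fun h => ⟨_, h.hasSchoenbergExpansion hm hM hK hf⟩,
      fun ⟨_, h⟩ => .of_hasSchoenbergExpansion hm hM hf h⟩⟩
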